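/- Conventions. For a finite separable extension of fields $L|K$ and a valuation $w$ of $L$ (arbitrary rank, possibly trivial) with restriction $v$ to $K$, call $w/v$ tamely ramified if the degree of the extension of strict henselisations $L_w^{sh}|K_v^{sh}$ is prime to the residue characteristic. Let $S$ be a base scheme. For an integral $S$-scheme $X$ put $\dim_S X=\mathrm{deg.tr.}(k(X)/k(T))+\dim_{\rm Krull}T$, where $T$ is the closure of the image of $X$ in $S$. A regular $S$-curve is a regular integral $S$-scheme $C$, separated and essentially of finite type over $S$, with $\dim_S C=1$; its regular compactification $\bar C$ is the (unique) regular integral scheme, proper over $S$, which contains $C$ as a dense subspace with the same local rings (it exists if $S$ is excellent). A finite étale cover (that is, a finite étale morphism) $Y\to X$ of $S$-schemes is curve-tame if for every $S$-morphism $C\to X$ from a regular $S$-curve $C$ the base change $Y\times_X C\to C$ is tamely ramified along $\bar C\setminus C$: for every $x\in\bar C\setminus C$ and every point $y$ of $Y\times_X C$ over the generic point of $C$, every extension to $k(y)$ of the discrete valuation of $k(C)$ with valuation ring $\mathcal O_{\bar C,x}$ is tamely ramified. An $S$-valuation of an $S$-scheme $X$ is a pair $(x,v)$, with $x\in X$ and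 $v$ a valuation on $k(x)$, such that $\mathrm{Spec}\,k(x)\to X\to S$ extends to a morphism $\mathrm{Spec}\,\mathcal O_v\to S$. A finite étale cover $Y\to X$ is tame if it is a covering in the tame site $(X/S)_t$: it is surjective and every $S$-valuation $(x,v)$ of $X$ is the image of an $S$-valuation $(y,w)$ of $Y$ with $w/v$ tamely ramified. It is Galois if it is surjective, $Y$ is connected and $\mathrm{Aut}(Y/X)$ acts transitively on the geometric fibres. Statement. Let $S$ be (the spectrum of) a henselian discrete valuation ring with uniformizer $\pi$, let $A$ be an $S$-algebra essentially of finite type, let $I=\pi A$, and assume that $(A,I)$ is a henselian pair. Then the functor $$B\mapsto B\otimes_A A/I$$ induces an equivalence between the category of finite étale curve-tame covers $\mathrm{Spec}(B)\to\mathrm{Spec}(A)$ and the category of finite étale curve-tame covers of $\mathrm{Spec}(A/I)$. If moreover $A$ and $A/I$ are geometrically unibranch, then the same functor induces an equivalence between the category of finite étale tame Galois covers of $\mathrm{Spec}(A)$ and the category of finite étale tame Galois covers of $\mathrm{Spec}(A/I)$. -/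

import Mathlib

open CategoryTheory AlgebraicGeometry

universe u

noncomputable section

namespace TameRigidity

/-! ### Tamely ramified extensions of valued fields -/

section Valuations

/-- The strict henselisation of `K` at the valuation with valuation ring `W ∩ K`, realised inside
a separable closure `Ω` of `K`: it is the fixed field of the inertia group of `W`. -/
def strictHenselization (K : Type u) {Ω : Type u} [Field K] [Field Ω] [Algebra K Ω]
    (W : ValuationSubring Ω) : IntermediateField K Ω :=
  IntermediateField.fixedField
    ((W.inertiaSubgroup K).map (W.decompositionSubgroup K).subtype)

/-- Let `L / K` be a finite separable extension of fields, `w` a valuation of `L` with valuation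
ring `W` and `v` its restriction to `K`.  Then `w / v` is tamely ramified if the degree of the
extension of strict henselisations `L_w^sh / K_v^sh` is prime to the residue characteristic.
If `v` is discrete, this says that the residue field extension is separable and that the
ramification index is prime to the residue characteristic. -/
def IsTamelyRamified (K : Type u) {L : Type u} [Field K] [Field L] [Algebra K L]
    (W : ValuationSubring L) : Prop :=
  ∀ (Ω : Type u) [Field Ω] [Algebra K Ω] [Algebra L Ω] [IsScalarTower K L Ω] [IsSepClosure L Ω]
    (W' : ValuationSubring Ω), W'.comap (algebraMap L Ω) = W →
    ((IntermediateField.relfinrank (strictHenselization K W')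
      ((strictHenselization L W').restrictScalars K) : ℕ) : IsLocalRing.ResidueField W) ≠ 0

/-- A point of a scheme together with a valuation (ring) on its residue field. -/
structure PointedValuation (X : Scheme.{u}) where
  point : X
  ring : ValuationSubring (X.residueField point)

/-- The image `(f y, w restricted to κ(f y))` of `(y, w)` under a morphism `f`. -/
def PointedValuation.map {X Y : Scheme.{u}} (f : Y ⟶ X) (b : PointedValuation Y) :
    PointedValuation X where
  point := f b.point
  ring := b.ring.comap (f.residueFieldMap b.point).hom

/-- `(y, w)` is tamely ramified over its image under `f`. -/
def PointedValuation.IsTame {X Y : Scheme.{u}} (f : Y ⟶ X) (b : PointedValuation Y) : Prop :=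
  letI := (f.residueFieldMap b.point).hom.toAlgebra
  IsTamelyRamified (X.residueField (f b.point)) b.ring

/-- `(x, v)` is an `S`-valuation on the `S`-scheme `p : X ⟶ S`. -/
def PointedValuation.IsSValuation {X S : Scheme.{u}} (p : X ⟶ S) (a : PointedValuation X) :
    Prop :=
  ∃ ψ : Spec (CommRingCat.of a.ring) ⟶ S,
    Spec.map (CommRingCat.ofHom a.ring.subtype) ≫ ψ = X.fromSpecResidueField a.point ≫ p

/-- `f : Y ⟶ X` is a covering in the tame site `(X / S)_t`. -/
def IsTameCovering {X Y S : Scheme.{u}} (p : X ⟶ S) (f : Y ⟶ X) : Prop :=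
  Etale f ∧ Surjective f ∧ ∀ a : PointedValuation X, a.IsSValuation p →
    ∃ b : PointedValuation Y, b.IsSValuation (f ≫ p) ∧ b.map f = a ∧ b.IsTame f

end Valuations

/-! ### Regular curves over a base and curve-tame covers -/

section Curves

/-- A morphism is essentially of finite type if it is quasi-compact and, locally on the source,
given by ring maps essentially of finite type. -/
structure IsEssFiniteType {X S : Scheme.{u}} (p : X ⟶ S) : Prop where
  quasiCompact : QuasiCompact p
  locally_essFiniteType : ∀ x : X, ∃ (V : S.Opens) (U : X.Opens) (e : U ≤ p ⁻¹ᵁ V),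
    IsAffineOpen V ∧ IsAffineOpen U ∧ x ∈ U ∧ (p.appLE V U e).hom.EssFiniteType

/-- A regular scheme. -/
structure IsRegularScheme (X : Scheme.{u}) : Prop where
  locallyNoetherian : IsLocallyNoetherian X
  regular : ∀ x : X, IsRegularLocalRing (X.presheaf.stalk x)

/-- `dim_S X = trdeg (k(X) / k(T)) + dim T` for `X` integral, where `T` is the closure of the
image of `X` in `S`. -/
def relativeDim {X S : Scheme.{u}} [IrreducibleSpace X] (p : X ⟶ S) : WithBot ℕ∞ :=
  letI := (p.residueFieldMap (genericPoint X)).hom.toAlgebra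
  ((Cardinal.toENat (Algebra.trdeg (S.residueField (p (genericPoint X)))
      (X.residueField (genericPoint X))) : ℕ∞) : WithBot ℕ∞) +
    topologicalKrullDim (closure (Set.range p))

/-- A regular connected `S`-curve `q : C ⟶ S`. -/
structure IsRegularCurve {C S : Scheme.{u}} (q : C ⟶ S) : Prop where
  integral : IsIntegral C
  regular : IsRegularScheme C
  separated : IsSeparated q
  essFiniteType : IsEssFiniteType q
  dim_eq_one : relativeDim q = 1

/-- `j : C ⟶ Cb` identifies `C` with a dense subspace of the regular integral scheme `Cb`, proper
over `S`, so that the local rings of `C` are those of `Cb`.  (If `C` is of finite type over `S`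
this means that `j` is a dense open immersion.) -/
structure IsRegularCompactification {C Cb S : Scheme.{u}} (q : C ⟶ S) (qb : Cb ⟶ S)
    (j : C ⟶ Cb) : Prop where
  w : j ≫ qb = q
  integral : IsIntegral Cb
  regular : IsRegularScheme Cb
  proper : IsProper qb
  dominant : IsDominant j
  preimmersion : IsPreimmersion j
  stalk_iso : ∀ c : C, IsIso (j.stalkMap c)

lemma specializes_of_isDominant {C Cb : Scheme.{u}} [IrreducibleSpace C] (j : C ⟶ Cb)
    [IsDominant j] {c : C} (hc : c = genericPoint C) (x : Cb) : j c ⤳ x := by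
  subst hc
  rw [specializes_iff_mem_closure]
  have h1 : Set.range j ⊆ closure {j (genericPoint C)} := by
    rintro _ ⟨c, rfl⟩
    exact ((genericPoint_specializes c).map j.continuous).mem_closure
  exact closure_minimal h1 isClosed_closure (j.denseRange x)

/-- If `x` is a specialisation of `η`, the image of `𝒪_{X, x}` in the residue field of `η`.
If `X` is integral with generic point `η`, this is `𝒪_{X, x}` as a subring of the function
field. -/
def localRingAt {X : Scheme.{u}} {η x : X} (h : η ⤳ x) : Subring (X.residueField η) :=
  (X.presheaf.stalkSpecializes h ≫ X.residue η).hom.range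

/-- For `j : C ⟶ Cb` a regular compactification, the étale morphism `g : C' ⟶ C` is tamely
ramified along `Cb ∖ C`: for every point `x ∈ Cb ∖ C` and every point `y` of `C'` over the generic
point of `C`, every extension `w` to `κ(y)` of the discrete valuation of the function field of `C`
with valuation ring `𝒪_{Cb, x}` is tamely ramified. -/
def IsTamelyRamifiedAlongBoundary {C C' Cb : Scheme.{u}} [IrreducibleSpace C] (j : C ⟶ Cb)
    [IsDominant j] (g : C' ⟶ C) : Prop :=
  ∀ x : Cb, x ∉ Set.range j → ∀ b : PointedValuation C',
    ∀ hb : g b.point = genericPoint C,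
    ((b.map g).map j).ring.toSubring = localRingAt (specializes_of_isDominant j hb x) →
    b.IsTame g

/-- The étale cover `f : Y ⟶ X` of schemes over `S` is curve-tame: its base change to every
regular `S`-curve `φ : C ⟶ X` is tamely ramified along the boundary of the regular
compactification of `C` over `S` (which is unique). -/
def IsCurveTame {X Y S : Scheme.{u}} (p : X ⟶ S) (f : Y ⟶ X) : Prop :=
  ∀ (C : Scheme.{u}) (φ : C ⟶ X) (hC : IsRegularCurve (φ ≫ p))
    (Cb : Scheme.{u}) (qb : Cb ⟶ S) (j : C ⟶ Cb) (hj : IsRegularCompactification (φ ≫ p) qb j),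
    haveI := hC.integral
    haveI := hj.dominant
    IsTamelyRamifiedAlongBoundary j (Limits.pullback.fst φ f)

end Curves

/-! ### Geometrically unibranch rings -/

section Unibranch

/-- A local ring is geometrically unibranch if its reduction is a domain whose integral closure in
its fraction field is local, with residue field purely inseparable over that of the ring. -/
def IsGeometricallyUnibranchLocal (A : Type u) [CommRing A] [IsLocalRing A] : Prop :=
  (nilradical A).IsPrime ∧
  ∃ (_ : IsLocalRing (integralClosure (A ⧸ nilradical A) (FractionRing (A ⧸ nilradical A))))
    (_ : IsLocalHom (algebraMap A
      (integralClosure (A ⧸ nilradical A) (FractionRing (A ⧸ nilradical A))))),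
    (IsLocalRing.ResidueField.map (algebraMap A
      (integralClosure (A ⧸ nilradical A)
        (FractionRing (A ⧸ nilradical A))))).IsPurelyInseparable

/-- All local rings are geometrically unibranch. -/
def IsGeometricallyUnibranch (A : Type u) [CommRing A] : Prop :=
  ∀ (P : Ideal A) [P.IsPrime], IsGeometricallyUnibranchLocal (Localization.AtPrime P)

end Unibranch

/-! ### Categories of finite covers -/

section Covers

variable (R : Type u) [CommRing R] (A : Type u) [CommRing A] [Algebra R A]

/-- The morphism `Spec B ⟶ Spec A` of an `A`-algebra `B`. -/
abbrev specMap (A B : Type u) [CommRing A] [CommRing B] [Algebra A B] :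
    Spec (CommRingCat.of B) ⟶ Spec (CommRingCat.of A) :=
  Spec.map (CommRingCat.ofHom (algebraMap A B))

/-- Finite étale covers `Spec B ⟶ Spec A` which are curve-tame over `Spec R`. -/
def curveTameCovers : ObjectProperty (CommAlgCat.FiniteEtale.{u} A) :=
  fun B ↦ IsCurveTame (specMap R A) (specMap A B.obj)

/-- A finite étale cover `Spec B ⟶ Spec A` is Galois if it is surjective, `Spec B` is connected and
the group of automorphisms of `Spec B` over `Spec A` acts transitively on the geometric fibres. -/
structure IsGaloisCover (B : Type u) [CommRing B] [Algebra A B] : Prop where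
  connected : ConnectedSpace (PrimeSpectrum B)
  surjective : Function.Surjective (PrimeSpectrum.comap (algebraMap A B))
  transitive : ∀ (Ω : Type u) [Field Ω] [IsAlgClosed Ω] [Algebra A Ω] (s t : B →ₐ[A] Ω),
    ∃ σ : B ≃ₐ[A] B, t = s.comp (σ : B →ₐ[A] B)

/-- Finite étale Galois covers `Spec B ⟶ Spec A` which are coverings in `(Spec A / Spec R)_t`. -/
def tameGaloisCovers : ObjectProperty (CommAlgCat.FiniteEtale.{u} A) :=
  fun B ↦ IsGaloisCover A B.obj ∧ IsTameCovering (specMap R A) (specMap A B.obj)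

end Covers

/-- The functor `F` maps the full subcategory `P` to the full subcategory `Q`, and the induced
functor is an equivalence of categories. -/
def InducesEquivalence {𝒞 : Type*} {𝒟 : Type*} [Category 𝒞] [Category 𝒟] (F : 𝒞 ⥤ 𝒟)
    (P : ObjectProperty 𝒞) (Q : ObjectProperty 𝒟) : Prop :=
  ∃ h : ∀ X, P X → Q (F.obj X),
    (Q.lift (P.ι ⋙ F) (fun X ↦ h X.obj X.property)).IsEquivalence

end TameRigidity

end

namespace TameRigidity

open Polynomial TensorProduct

/-! ### Lifting sections, factorizations and idempotents along a henselian pair -/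

section IdempotentLifting

variable {A : Type*} [CommRing A] {I : Ideal A}

/-! Two facts combine: over the noetherian henselian pair (A, I) reduction modulo I is an
equivalence on all finite étale algebras, and each property in the statement holds for B if and only
if it holds for B/IB. `inducesEquivalence_baseChange` assembles the two.

The decisive point is that tameness is a condition on the special fibre only. Let ρ : A → K be a map
to a field with ρ(π) ≠ 0, and let l be 2 or 3, whichever is a unit in R. By henselianity 1 + πa has
an lⁿ-th root in A for every n. The fraction field of ρ(A) is finitely generated over Frac R, and in
such a field an element with lⁿ-th roots for all n is algebraic. Hence ρ(a) is algebraic over R, and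
even integral because R is henselian (`isIntegralElem_of_map_ne_zero`). A valuation ring containing
the image of R therefore contains ρ(A): every S-valuation at a point with π ≠ 0 has a centre on Spec
A, and a finite étale cover of Spec A is unramified there (`isTame_of_isSValuation`). All other test
curves and valuations lie on Spec A/I. This gives `isCurveTame_iff` and `isTameCovering_iff`.

The equivalence for finite étale algebras is derived from the lifting of simple roots. Applied to a
characteristic polynomial, root lifting lifts étale sections of finite algebras
(`exists_algHom_of_etale`); applied to the universal factorization ring, this lifts coprime
factorizations, and these lift idempotents of integral algebras (`exists_isIdempotentElem_sub_mem`).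
Idempotents of B ⊗ C lift homomorphisms. For essential surjectivity, an étale lift is obtained from
a presentation, and Zariski's main theorem with idempotent lifting cuts out its finite part
(`exists_finite_etale_lift`).

For the Galois condition, connectedness is a matter of idempotents, and transitivity is the covering
of Spec (B ⊗ B) by graphs of automorphisms, which can be tested at maximal ideals, all of which lie
over I (`isGaloisCover_iff`). -/

lemma map_le_jacobson_bot (hI : I ≤ Ideal.jacobson ⊥) (E : Type*) [CommRing E] [Algebra A E]
    [Algebra.IsIntegral A E] : I.map (algebraMap A E) ≤ Ideal.jacobson ⊥ := by
  rw [Ideal.map_le_iff_le_comap]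
  intro a ha
  rw [Ideal.mem_comap, Ideal.jacobson, Ideal.mem_sInf]
  rintro M ⟨-, hM⟩
  have hM' : (M.comap (algebraMap A E)).IsMaximal := Ideal.isMaximal_comap_of_isIntegral_of_isMaximal M
  exact (Ideal.mem_sInf.mp (hI ha)) ⟨bot_le, hM'⟩

lemma isUnit_of_isUnit_mk {E : Type*} [CommRing E] {J : Ideal E} (hJ : J ≤ Ideal.jacobson ⊥) {x : E}
    (hx : IsUnit (Ideal.Quotient.mk J x)) : IsUnit x := by
  have := isLocalHom_of_le_jacobson_bot J hJ
  exact isUnit_of_map_unit _ _ hx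

lemma isUnit_of_sub_one_mem {E : Type*} [CommRing E] {J : Ideal E} (hJ : J ≤ Ideal.jacobson ⊥)
    {x : E} (hx : x - 1 ∈ J) : IsUnit x := by
  refine isUnit_of_isUnit_mk hJ ?_
  rw [Ideal.Quotient.eq.mpr hx]
  simp

lemma IsIdempotentElem.eq_zero_of_mem_jacobson {E : Type*} [CommRing E] {e : E}
    (he : IsIdempotentElem e) (h : e ∈ Ideal.jacobson (⊥ : Ideal E)) : e = 0 := by
  have hu : IsUnit (1 - e) := isUnit_of_sub_one_mem le_rfl (by simpa using h)
  have : (1 - e) * e = 0 := by rw [sub_mul, one_mul, he, sub_self]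
  simpa using (hu.mul_right_eq_zero).mp this

/-- An unramified section of the fibre splits off. -/
lemma exists_splitting_of_formallyUnramified {E : Type*} [CommRing E] [Algebra A E]
    [IsNoetherianRing E] (σ : E →ₐ[A] A ⧸ I) (r : E)
    [Algebra.FormallyUnramified A (Localization.Away r)] (hr : IsUnit (σ r)) :
    ∃ δ : E, σ δ = 1 ∧ ∀ x, σ x = 0 → δ * x ∈ I.map (algebraMap A E) := by
  let K : Ideal E := RingHom.ker σ
  have hIK : I.map (algebraMap A E) ≤ K := by
    rw [Ideal.map_le_iff_le_comap]
    intro a ha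
    rw [Ideal.mem_comap, RingHom.mem_ker, AlgHom.commutes]
    exact Ideal.Quotient.eq_zero_iff_mem.mpr ha
  -- The quotient map E → E/Q and the map through σ agree modulo the square-zero ideal K/Q. Both
  -- extend to the unramified algebra E_r, so they coincide, which says K ≤ K² + IE.
  let Q : Ideal E := K ^ 2 ⊔ I.map (algebraMap A E)
  let B := E ⧸ Q
  let f₁ : E →ₐ[A] B := Ideal.Quotient.mkₐ A Q
  let f₂ : E →ₐ[A] B := (Ideal.Quotient.liftₐ I (Algebra.ofId A B) (fun a ha ↦
    Ideal.Quotient.eq_zero_iff_mem.mpr (Ideal.mem_sup_right (Ideal.mem_map_of_mem _ ha)))).comp σ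
  let Kb : Ideal B := K.map (Ideal.Quotient.mk Q)
  have hKb : Kb ^ 2 = ⊥ := by
    change (K.map (Ideal.Quotient.mk Q)) ^ 2 = ⊥
    rw [← Ideal.map_pow, eq_bot_iff, Ideal.map_le_iff_le_comap]
    intro x hx
    rw [Ideal.mem_comap, Ideal.mem_bot]
    exact Ideal.Quotient.eq_zero_iff_mem.mpr (Ideal.mem_sup_left hx)
  have hdiff' (x : E) : ∃ a : A, σ x = Ideal.Quotient.mk I a ∧ x - algebraMap A E a ∈ K := by
    obtain ⟨a, ha⟩ := Ideal.Quotient.mk_surjective (σ x)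
    refine ⟨a, ha.symm, ?_⟩
    rw [RingHom.mem_ker, map_sub, AlgHom.commutes, ← ha]
    exact sub_self _
  have hf₂ (x : E) (a : A) (h : σ x = Ideal.Quotient.mk I a) :
      f₂ x = Ideal.Quotient.mk Q (algebraMap A E a) := by
    simp only [f₂, AlgHom.comp_apply, h]
    exact Ideal.Quotient.lift_mk _ _ _
  have hdiff (x : E) : f₁ x - f₂ x ∈ Kb := by
    obtain ⟨a, ha, hx⟩ := hdiff' x
    rw [hf₂ x a ha]
    exact Ideal.mem_map_of_mem (Ideal.Quotient.mk Q) hx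
  have hu₂ : IsUnit (f₂ r) := IsUnit.map (Ideal.Quotient.liftₐ I (Algebra.ofId A B) (fun a ha ↦
    Ideal.Quotient.eq_zero_iff_mem.mpr (Ideal.mem_sup_right (Ideal.mem_map_of_mem _ ha)))) hr
  have hu₁ : IsUnit (f₁ r) := by
    have hn : IsNilpotent (f₁ r - f₂ r) := by
      refine ⟨2, ?_⟩
      have := Ideal.pow_mem_pow (hdiff r) 2
      rwa [hKb] at this
    have := hn.isUnit_add_right_of_commute hu₂ (mul_comm _ _)
    simpa using this
  let g₁ : Localization.Away r →ₐ[A] B := IsLocalization.liftAlgHom (M := .powers r) (f := f₁)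
    (by rintro ⟨_, n, rfl⟩; simpa only [map_pow] using hu₁.pow n)
  let g₂ : Localization.Away r →ₐ[A] B := IsLocalization.liftAlgHom (M := .powers r) (f := f₂)
    (by rintro ⟨_, n, rfl⟩; simpa only [map_pow] using hu₂.pow n)
  have hg₁ (x : E) : g₁ (algebraMap _ _ x) = f₁ x := IsLocalization.lift_eq _ _
  have hg₂ (x : E) : g₂ (algebraMap _ _ x) = f₂ x := IsLocalization.lift_eq _ _
  have hg : g₁ = g₂ := by
    refine Algebra.FormallyUnramified.ext Kb ⟨2, hKb⟩ fun x ↦ ?_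
    have : ((Ideal.Quotient.mkₐ A Kb).comp g₁) = ((Ideal.Quotient.mkₐ A Kb).comp g₂) := by
      refine IsLocalization.algHom_ext (.powers r) ?_
      ext x
      have := Ideal.Quotient.eq.mpr (hdiff x)
      change Ideal.Quotient.mk Kb (g₁ (algebraMap _ _ x)) = Ideal.Quotient.mk Kb (g₂ (algebraMap _ _ x))
      rw [hg₁, hg₂]
      exact this
    exact DFunLike.congr_fun this x
  have hKQ : K ≤ Q := fun x hx ↦ by
    have h0 : f₁ x = f₂ x := by rw [← hg₁, ← hg₂, hg]
    rw [hf₂ x 0 (by simpa using! hx)] at h0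
    simpa using Ideal.Quotient.eq.mp h0
  -- Modulo IE the kernel is idempotent and finitely generated, hence generated by an idempotent k;
  -- then δ = 1 - k.
  let K₀ := K.map (Ideal.Quotient.mk (I.map (algebraMap A E)))
  have hK2 : IsIdempotentElem K₀ := by
    rw [IsIdempotentElem, ← pow_two]
    refine le_antisymm (Ideal.pow_le_self two_ne_zero) ?_
    rw [← Ideal.map_pow]
    refine (Ideal.map_mono hKQ).trans ?_
    rw [Ideal.map_sup, Ideal.map_quotient_self, sup_bot_eq]
  obtain ⟨k, hk, hKk⟩ := (Ideal.isIdempotentElem_iff_of_fg _ (K₀.fg_of_isNoetherianRing)).mp hK2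
  obtain ⟨k, rfl⟩ := Ideal.Quotient.mk_surjective k
  have hmem (x : E) : x ∈ K ↔ Ideal.Quotient.mk (I.map (algebraMap A E)) x ∈ K₀ := by
    rw [← Ideal.mem_comap, Ideal.comap_map_of_surjective _ Ideal.Quotient.mk_surjective,
      ← RingHom.ker_eq_comap_bot, Ideal.mk_ker, sup_of_le_left hIK]
  have hk0 : k ∈ K := by
    rw [hmem, hKk]
    exact Ideal.mem_span_singleton_self _
  refine ⟨1 - k, ?_, fun x hx ↦ ?_⟩
  · rw [map_sub, map_one, show σ k = 0 from hk0, sub_zero]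
  · have := (hmem x).mp hx
    rw [hKk, Ideal.mem_span_singleton'] at this
    obtain ⟨c, hc⟩ := this
    rw [← Ideal.Quotient.eq_zero_iff_mem, map_mul, ← hc, map_sub, map_one, sub_mul, one_mul,
      mul_left_comm, hk, sub_self]

/-- Lifting an idempotent of rank one. -/
lemma exists_isIdempotentElem_of_splitting [HenselianRing A I] {E : Type*} [CommRing E]
    [Algebra A E] [Module.Finite A E] (σ : E →ₐ[A] A ⧸ I) (δ : E) (hδ : σ δ = 1)
    (h : ∀ x, σ x = 0 → δ * x ∈ I.map (algebraMap A E)) :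
    ∃ ε : E, IsIdempotentElem ε ∧ ε - δ ∈ I.map (algebraMap A E) := by
  classical
  have hjac : I ≤ Ideal.jacobson ⊥ := HenselianRing.jac
  obtain ⟨s, hs⟩ := (Module.Finite.fg_top : (⊤ : Submodule A E).FG)
  -- Generators adapted to δ: since δx ≡ aδ modulo IE for some a ∈ A, each generator x is congruent
  -- to aδ + (1 - δ)x, and Nakayama applies.
  let b : Option s → E := fun i ↦ i.elim δ (fun x ↦ (1 - δ) * x)
  have hsmul (x : E) : x ∈ I.map (algebraMap A E) ↔ x ∈ I • (⊤ : Submodule A E) := by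
    rw [Ideal.smul_top_eq_map]; rfl
  have hδx (x : E) : ∃ a : A, σ x = Ideal.Quotient.mk I a ∧
      δ * x - a • δ ∈ I.map (algebraMap A E) := by
    obtain ⟨a, ha⟩ := Ideal.Quotient.mk_surjective (σ x)
    refine ⟨a, ha.symm, ?_⟩
    have := h (x - algebraMap A E a) (by
      rw [map_sub, AlgHom.commutes, ← ha]; exact sub_self _)
    rwa [mul_sub, mul_comm δ (algebraMap A E a), ← Algebra.smul_def] at this
  have hb : Submodule.span A (Set.range b) = ⊤ := by
    rw [eq_top_iff]
    refine Submodule.le_of_le_smul_of_le_jacobson_bot (I := I) Module.Finite.fg_top hjac ?_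
    rw [← hs, Submodule.span_le]
    intro x hx
    obtain ⟨a, -, ha⟩ := hδx x
    have h1 : a • b none + b (some ⟨x, hx⟩) ∈ Submodule.span A (Set.range b) :=
      add_mem (Submodule.smul_mem _ _ (Submodule.subset_span ⟨_, rfl⟩))
        (Submodule.subset_span ⟨_, rfl⟩)
    rw [hs]
    have := add_mem (Submodule.mem_sup_left h1) (Submodule.mem_sup_right ((hsmul _).mp ha))
    convert! this using 1
    simp only [b, Option.elim]
    ring
  let D : Matrix (Option s) (Option s) A := Matrix.diagonal (fun i ↦ i.elim 1 (fun _ ↦ 0))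
  have hcoef (i : Option s) : ∃ c : Option s → A, (∀ j, c j ∈ I) ∧
      ∑ j, c j • b j = δ * b i - ∑ j, D j i • b j := by
    have hmem : δ * b i - ∑ j, D j i • b j ∈ I • (⊤ : Submodule A E) := by
      rw [← hsmul]
      have hDi : ∑ j, D j i • b j = D i i • b i := by
        refine Finset.sum_eq_single i (fun j _ hj ↦ ?_) (by simp)
        rw [show D j i = 0 from Matrix.diagonal_apply_ne _ hj, zero_smul]
      rw [hDi, show D i i = _ from Matrix.diagonal_apply_eq _ i]
      cases i with
      | none =>
        have := h (δ - 1) (by rw [map_sub, hδ, map_one, sub_self])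
        convert! this using 1
        simp only [b, Option.elim, one_smul]
        ring
      | some x =>
        have := Ideal.mul_mem_right (x : E) _ (h (1 - δ) (by rw [map_sub, hδ, map_one, sub_self]))
        convert! this using 1
        simp only [b, Option.elim, zero_smul]
        ring
    rw [← hb, Submodule.mem_ideal_smul_span_iff_exists_sum] at hmem
    obtain ⟨c, hc, hc'⟩ := hmem
    refine ⟨c, hc, ?_⟩
    rw [← hc', Finsupp.sum_fintype _ _ (by simp)]
  choose c hcI hc using hcoef
  -- Multiplication by δ has a matrix congruent to diag(1, 0, …, 0) modulo I, so its characteristic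
  -- polynomial reduces to (X - 1)X^|s|.
  let M : Matrix (Option s) (Option s) A := fun j i ↦ D j i + c i j
  have hM : M.Represents b (LinearMap.mulLeft A δ) := by
    rw [Matrix.represents_iff' ]
    intro i
    simp only [M, add_smul, Finset.sum_add_distrib, hc]
    simp
  let F := M.charpoly
  have hFm : F.Monic := M.charpoly_monic
  have hF0 : aeval δ F = 0 := by
    let Mr : Matrix.isRepresentation A b := ⟨M, _, hM⟩
    have h1 : aeval (Matrix.isRepresentation.toEnd A b hb Mr) F = 0 := by
      rw [Polynomial.aeval_algHom_apply, ← map_zero (Matrix.isRepresentation.toEnd A b hb)]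
      congr 1
      ext1
      rw [Polynomial.aeval_subalgebra_coe, Matrix.aeval_self_charpoly, Subalgebra.coe_zero]
    rw [Matrix.isRepresentation.eq_toEnd_of_represents A b hb Mr hM,
      show LinearMap.mulLeft A δ = Algebra.lmul A E δ from rfl, Polynomial.aeval_algHom_apply] at h1
    simpa using LinearMap.congr_fun h1 1
  have hFI : F.map (Ideal.Quotient.mk I) = (X - 1) * X ^ (Fintype.card s) := by
    have hMI : M.map (Ideal.Quotient.mk I) =
        Matrix.diagonal (fun i ↦ i.elim 1 (fun _ ↦ 0)) := by
      ext j i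
      have : Ideal.Quotient.mk I (c i j) = 0 := Ideal.Quotient.eq_zero_iff_mem.mpr (hcI i j)
      change Ideal.Quotient.mk I (D j i + c i j) = _
      rw [map_add, this, add_zero]
      by_cases hij : j = i
      · subst hij
        cases j <;> simp [D]
      · simp [hij, D]
    rw [← Matrix.charpoly_map, hMI, Matrix.charpoly_diagonal, Fintype.prod_option]
    simp
  -- The root 1 is simple modulo I, so it lifts to a root a.
  obtain ⟨a, ha, ha1⟩ := HenselianRing.is_henselian (I := I) F hFm 1 (by
    rw [← Ideal.Quotient.eq_zero_iff_mem, ← Polynomial.eval_map_apply, hFI]; simp) (by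
    rw [← Polynomial.eval_map_apply, ← Polynomial.derivative_map, hFI]; simp)
  obtain ⟨q, hq⟩ := Polynomial.dvd_iff_isRoot.mpr ha
  have hamk : Ideal.Quotient.mk I a = 1 := by
    rw [← sub_eq_zero, ← map_one (Ideal.Quotient.mk I), ← map_sub]
    exact Ideal.Quotient.eq_zero_iff_mem.mpr ha1
  have hqI : q.map (Ideal.Quotient.mk I) = X ^ (Fintype.card s) := by
    have h1 : (X - 1 : (A ⧸ I)[X]) * q.map (Ideal.Quotient.mk I) =
        (X - 1) * X ^ (Fintype.card s) := by
      rw [← hFI, hq]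
      simp [hamk]
    exact (Polynomial.monic_X_sub_C (1 : A ⧸ I)).isRegular.left (by simpa using h1)
  have hqa : IsUnit (q.eval a) := by
    refine isUnit_of_isUnit_mk hjac ?_
    rw [← Polynomial.eval_map_apply, hqI, hamk]
    simp
  have hroot : (δ - algebraMap A E a) * aeval δ q = 0 := by
    rw [← hF0, hq]
    simp
  -- With F = (X - a)q and F(δ) = 0, δ acts on q(δ) as the scalar a. Hence q(δ)² = q(a)q(δ), and
  -- q(δ)/q(a) is idempotent.
  let v : A := (hqa.unit⁻¹ : Aˣ)
  have hv : v * q.eval a = 1 := hqa.val_inv_mul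
  have hqq : aeval δ q * aeval δ q = algebraMap A E (q.eval a) * aeval δ q := by
    obtain ⟨p, hp⟩ := Polynomial.X_sub_C_dvd_sub_C_eval (p := q) (a := a)
    have := congr_arg (aeval δ) hp
    simp only [map_sub, map_mul, aeval_X, aeval_C] at this
    rw [← sub_eq_zero, ← sub_mul, this, mul_right_comm, hroot, zero_mul]
  refine ⟨algebraMap A E v * aeval δ q, ?_, ?_⟩
  · have : algebraMap A E v * algebraMap A E (q.eval a) = 1 := by rw [← map_mul, hv, map_one]
    rw [IsIdempotentElem]
    linear_combination (algebraMap A E v) ^ 2 * hqq + algebraMap A E v * aeval δ q * this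
  · let m := Ideal.Quotient.mk (I.map (algebraMap A E))
    let ψ : A ⧸ I →+* E ⧸ I.map (algebraMap A E) := Ideal.quotientMap _ (algebraMap A E)
      Ideal.le_comap_map
    have hψ : m.comp (algebraMap A E) = ψ.comp (Ideal.Quotient.mk I) := by
      ext x
      simp [m, ψ]
    have hmδ : m δ ^ 2 = m δ := by
      have := h (δ - 1) (by rw [map_sub, hδ, map_one, sub_self])
      rw [← Ideal.Quotient.eq_zero_iff_mem, mul_sub, map_sub, mul_one, sub_eq_zero, map_mul] at this
      rw [pow_two]
      exact this
    have hmq : m (aeval δ q) = m δ ^ (Fintype.card s) := by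
      rw [Polynomial.aeval_def, Polynomial.hom_eval₂, hψ, ← Polynomial.eval₂_map, hqI]
      simp
    have hmv : m (algebraMap A E v) = 1 := by
      have h1 : Ideal.Quotient.mk I v = 1 := by
        have := congr_arg (Ideal.Quotient.mk I) hv
        rwa [map_mul, ← Polynomial.eval_map_apply, hqI, hamk, eval_pow, eval_X, one_pow, mul_one,
          map_one] at this
      rw [← RingHom.comp_apply, hψ, RingHom.comp_apply, h1, map_one]
    rw [← Ideal.Quotient.eq, map_mul]
    change m _ * m _ = m _
    rw [hmv, one_mul, hmq]
    -- The idempotent reduces to δ^|s|, which is the class of δ only for |s| > 0; for |s| = 0 the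
    -- algebra E is zero.
    rcases Nat.eq_zero_or_pos (Fintype.card s) with h0 | h0
    · have : Subsingleton E := by
        have hs0 : s = ∅ := by simpa using h0
        rw [hs0, Finset.coe_empty, Submodule.span_empty] at hs
        exact (Submodule.subsingleton_iff A).mp (subsingleton_of_bot_eq_top hs)
      rw [← map_pow]
      exact congr_arg m (Subsingleton.elim _ _)
    · exact IsIdempotentElem.pow_eq (by rw [IsIdempotentElem, ← pow_two, hmδ]) h0.ne'

/-- An étale section of the fibre which is cut out by an idempotent lifts. -/
lemma exists_algHom_of_isIdempotentElem [IsNoetherianRing A] (hI : I ≤ Ideal.jacobson ⊥)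
    {E : Type*} [CommRing E] [Algebra A E] [Module.Finite A E] (σ : E →ₐ[A] A ⧸ I) (r : E)
    [Algebra.FormallySmooth A (Localization.Away r)] (hr : IsUnit (σ r)) (ε : E)
    (hε : IsIdempotentElem ε) (hσ : σ ε = 1) (h : ∀ x, σ x = 0 → ε * x ∈ I.map (algebraMap A E)) :
    ∃ τ : E →ₐ[A] A, ∀ x, Ideal.Quotient.mk I (τ x) = σ x := by
  let N := E ⧸ Ideal.span {1 - ε}
  let m : E →ₐ[A] N := Ideal.Quotient.mkₐ A _
  have hm : Function.Surjective m := Ideal.Quotient.mk_surjective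
  have hm0 {x y : E} (hxy : m x = m y) : ε * x = ε * y := by
    obtain ⟨c, hc⟩ := Ideal.mem_span_singleton'.mp (Ideal.Quotient.eq.mp hxy)
    have : ε * (x - y) = 0 := by
      rw [← hc, mul_left_comm, mul_sub, mul_one, hε, sub_self, mul_zero]
    rwa [mul_sub, sub_eq_zero] at this
  have hmσ {x y : E} (hxy : m x = m y) : σ x = σ y := by
    simpa [hσ] using congr_arg σ (hm0 hxy)
  have hmε : m ε = 1 := by
    rw [← map_one m]
    refine (Ideal.Quotient.eq.mpr ?_).symm
    exact Ideal.mem_span_singleton_self _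
  let J : Ideal A := RingHom.ker (Algebra.ofId A N)
  have hJ (a : A) : a ∈ J ↔ m (algebraMap A E a) = 0 := Iff.rfl
  have hJI : J ≤ I := fun a ha ↦ by
    have := hmσ (((hJ a).mp ha).trans (map_zero m).symm)
    rw [AlgHom.commutes, map_zero] at this
    exact Ideal.Quotient.eq_zero_iff_mem.mp this
  -- Modulo I the factor N of E is spanned by 1, so by Nakayama N = A/J with J ≤ I. It remains to
  -- kill J.
  have hsurj : Function.Surjective (Algebra.ofId A N) := by
    have : (⊤ : Submodule A N) ≤ LinearMap.range (Algebra.ofId A N).toLinearMap := by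
      refine Submodule.le_of_le_smul_of_le_jacobson_bot (I := I) Module.Finite.fg_top hI ?_
      rintro y -
      obtain ⟨x, rfl⟩ := hm y
      obtain ⟨a, ha⟩ := Ideal.Quotient.mk_surjective (σ x)
      have hx := h (x - algebraMap A E a) (by rw [map_sub, AlgHom.commutes, ← ha]; exact sub_self _)
      have hx' : m (x - algebraMap A E a) ∈ I • (⊤ : Submodule A N) := by
        have h2 : m (x - algebraMap A E a) = m (ε * (x - algebraMap A E a)) := by
          rw [map_mul, hmε, one_mul]
        rw [h2, Ideal.smul_top_eq_map]
        have := Ideal.mem_map_of_mem (m : E →+* N) hx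
        rwa [Ideal.map_map, show (m : E →+* N).comp (algebraMap A E) = algebraMap A N from
          m.comp_algebraMap] at this
      have := add_mem (Submodule.mem_sup_left
        (show (Algebra.ofId A N) a ∈ LinearMap.range (Algebra.ofId A N).toLinearMap from ⟨a, rfl⟩))
        (Submodule.mem_sup_right hx')
      convert! this using 1
      rw [map_sub, AlgHom.commutes]
      simp [Algebra.ofId_apply]
    exact fun y ↦ this (Submodule.mem_top (x := y))
  let e : (A ⧸ J) ≃ₐ[A] N := Ideal.quotientKerAlgEquivOfSurjective hsurj
  let q : E →ₐ[A] A ⧸ J := (e.symm : N →ₐ[A] A ⧸ J).comp m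
  have hq (x : E) (a : A) (hxa : m x = algebraMap A N a) : q x = Ideal.Quotient.mk J a := by
    change e.symm (m x) = _
    rw [hxa, AlgEquiv.commutes]
    rfl
  have hrep (x : E) : ∃ a : A, m x = algebraMap A N a ∧ σ x = Ideal.Quotient.mk I a := by
    obtain ⟨a, ha⟩ := hsurj (m x)
    have ha' : m x = algebraMap A N a := ha.symm
    refine ⟨a, ha', ?_⟩
    rw [← m.commutes] at ha'
    rw [hmσ ha', AlgHom.commutes]
    rfl
  have hqr : IsUnit (q r) := by
    obtain ⟨a, ha, ha'⟩ := hrep r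
    rw [hq r a ha]
    exact (isUnit_of_isUnit_mk hI (ha' ▸ hr)).map _
  let φ : Localization.Away r →ₐ[A] A ⧸ J := IsLocalization.liftAlgHom (M := .powers r) (f := q)
    (by rintro ⟨_, n, rfl⟩; simpa only [map_pow] using hqr.pow n)
  let g : A ⧸ J ^ 2 →ₐ[A] A ⧸ J := Ideal.Quotient.factorₐ A (Ideal.pow_le_self two_ne_zero)
  have hg : Function.Surjective g :=
    Ideal.Quotient.factor_surjective (Ideal.pow_le_self two_ne_zero)
  have hgk : IsNilpotent (RingHom.ker (g : A ⧸ J ^ 2 →+* A ⧸ J)) := by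
    refine ⟨2, ?_⟩
    rw [show RingHom.ker (g : A ⧸ J ^ 2 →+* A ⧸ J) = J.map (Ideal.Quotient.mk (J ^ 2)) from
      Ideal.Quotient.factor_ker (Ideal.pow_le_self two_ne_zero), ← Ideal.map_pow, Ideal.map_quotient_self]
    rfl
  let ψ : Localization.Away r →ₐ[A] A ⧸ J ^ 2 := Algebra.FormallySmooth.liftOfSurjective φ g hg hgk
  have hψ (x : E) : g (ψ (algebraMap _ _ x)) = q x := by
    exact (Algebra.FormallySmooth.liftOfSurjective_apply φ g hg hgk _).trans
      (IsLocalization.lift_eq _ _)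
  -- By smoothness E → A/J lifts to ψ : E → A/J². For a ∈ J one has εa = 0 in E, while ψ(ε) ≡ 1
  -- modulo J; hence a ∈ J².
  have hJ2 : J ≤ J * J := fun a ha ↦ by
    obtain ⟨b, hb⟩ := Ideal.Quotient.mk_surjective (ψ (algebraMap _ _ ε))
    have hb1 : b - 1 ∈ J := by
      rw [← Ideal.Quotient.eq]
      have h1 := hψ ε
      rw [← hb, hq ε 1 (by rw [hmε, map_one])] at h1
      exact h1
    have h0 : ε * algebraMap A E a = 0 := by
      rw [hm0 (((hJ a).mp ha).trans (map_zero m).symm), mul_zero]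
    have h1 := congr_arg (fun x ↦ ψ (algebraMap _ _ x)) h0
    simp only [map_mul, map_zero, ← IsScalarTower.algebraMap_apply, AlgHom.commutes, ← hb] at h1
    have h2 : b * a ∈ J ^ 2 := by
      rw [← Ideal.Quotient.eq_zero_iff_mem, map_mul]
      exact h1
    rw [pow_two] at h2
    have h3 := sub_mem h2 (Ideal.mul_mem_mul hb1 ha)
    convert! h3 using 1
    ring
  have hJ0 : J = ⊥ :=
    Submodule.eq_bot_of_le_smul_of_le_jacobson_bot J J J.fg_of_isNoetherianRing hJ2 (hJI.trans hI)
  let e' : A ≃ₐ[A] N := AlgEquiv.ofBijective (Algebra.ofId A N)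
    ⟨(RingHom.injective_iff_ker_eq_bot _).mpr hJ0, hsurj⟩
  refine ⟨(e'.symm : N →ₐ[A] A).comp m, fun x ↦ ?_⟩
  obtain ⟨a, ha, ha'⟩ := hrep x
  rw [ha']
  congr 1
  exact e'.injective (by simpa [e'] using! ha)

/-- A section of the fibre of a finite algebra over a henselian pair lifts if the algebra is étale
at this section. -/
theorem exists_algHom_of_etale [IsNoetherianRing A] [HenselianRing A I]
    {E : Type*} [CommRing E] [Algebra A E] [Module.Finite A E] (σ : E →ₐ[A] A ⧸ I) (r : E)
    [Algebra.Etale A (Localization.Away r)] (hr : IsUnit (σ r)) :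
    ∃ τ : E →ₐ[A] A, ∀ x, Ideal.Quotient.mk I (τ x) = σ x := by
  have : IsNoetherianRing E := .of_finite A E
  obtain ⟨δ, hδ, h⟩ := exists_splitting_of_formallyUnramified σ r hr
  obtain ⟨ε, hε, hεδ⟩ := exists_isIdempotentElem_of_splitting σ δ hδ h
  have hIK : I.map (algebraMap A E) ≤ RingHom.ker σ := by
    rw [Ideal.map_le_iff_le_comap]
    intro a ha
    rw [Ideal.mem_comap, RingHom.mem_ker, AlgHom.commutes]
    exact Ideal.Quotient.eq_zero_iff_mem.mpr ha
  refine exists_algHom_of_isIdempotentElem HenselianRing.jac σ r hr ε hε ?_ fun x hx ↦ ?_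
  · rw [← hδ, ← sub_eq_zero, ← map_sub]
    exact hIK hεδ
  · have := add_mem (h x hx) (Ideal.mul_mem_right x _ hεδ)
    convert! this using 1
    ring

/-- Coprime factorizations of monic polynomials lift along henselian pairs. -/
theorem exists_factorization [IsNoetherianRing A] [HenselianRing A I] {n m k : ℕ} (hn : n = m + k)
    (p : MonicDegreeEq A n) (f₀ : MonicDegreeEq (A ⧸ I) m) (g₀ : MonicDegreeEq (A ⧸ I) k)
    (h : f₀.1 * g₀.1 = p.1.map (Ideal.Quotient.mk I)) (hc : IsCoprime f₀.1 g₀.1) :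
    ∃ (f : MonicDegreeEq A m) (g : MonicDegreeEq A k), f.1 * g.1 = p.1 ∧
      f.1.map (Ideal.Quotient.mk I) = f₀.1 ∧ g.1.map (Ideal.Quotient.mk I) = g₀.1 := by
  -- Factorizations of p into monic factors of degrees m and k are the points of a finite A-algebra,
  -- which is étale where its Jacobian is invertible, the coprime locus. The given factorization is
  -- a section over A/I landing in that locus.
  let σ' := (UniversalCoprimeFactorizationRing.homEquiv (A ⧸ I) m k hn p).symm
    ⟨(f₀, g₀), h, hc⟩
  have hσ' : (UniversalCoprimeFactorizationRing.homEquiv (A ⧸ I) m k hn p σ').1 = (f₀, g₀) := by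
    simp [σ']
  let σ : UniversalFactorizationRing m k hn p →ₐ[A] A ⧸ I :=
    σ'.comp (IsScalarTower.toAlgHom _ _ _)
  obtain ⟨τ, hτ⟩ := exists_algHom_of_etale σ (UniversalFactorizationRing.presentation m k hn p).jacobian
    ((IsLocalization.Away.algebraMap_isUnit
      (UniversalFactorizationRing.presentation m k hn p).jacobian).map σ')
  have hτσ : (Ideal.Quotient.mk I).comp (τ : UniversalFactorizationRing m k hn p →+* A) = σ :=
    RingHom.ext hτ
  let q := UniversalFactorizationRing.homEquiv A m k hn p τ
  refine ⟨q.1.1, q.1.2, by simpa using q.2, ?_, ?_⟩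
  · change ((UniversalFactorizationRing.factor₁ m k hn p).1.map (τ : UniversalFactorizationRing m k hn p →+* A)).map _ = _
    rw [Polynomial.map_map, hτσ]
    exact congr_arg (fun x ↦ x.1.1) hσ'
  · change ((UniversalFactorizationRing.factor₂ m k hn p).1.map (τ : UniversalFactorizationRing m k hn p →+* A)).map _ = _
    rw [Polynomial.map_map, hτσ]
    exact congr_arg (fun x ↦ x.2.1) hσ'

/-- Idempotents of integral algebras lift along henselian pairs. -/
theorem exists_isIdempotentElem_sub_mem [IsNoetherianRing A] [HenselianRing A I]
    {B : Type*} [CommRing B] [Algebra A B] [Algebra.IsIntegral A B] (b : B)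
    (hb : b * b - b ∈ I.map (algebraMap A B)) :
    ∃ e : B, IsIdempotentElem e ∧ e - b ∈ I.map (algebraMap A B) := by
  have hI : I ≤ Ideal.jacobson ⊥ := HenselianRing.jac
  rcases subsingleton_or_nontrivial A with hA | hA
  · have : Subsingleton B := Algebra.subsingleton A B
    exact ⟨b, Subsingleton.elim _ _, by simp⟩
  have : Nontrivial (A ⧸ I) := by
    rw [Ideal.Quotient.nontrivial_iff]
    rintro rfl
    exact not_isUnit_zero (isUnit_of_sub_one_mem hI (x := (0 : A)) trivial)
  obtain ⟨g', hg', hgb', hgI'⟩ := Polynomial.exists_monic_aeval_eq_zero_forall_mem_of_mem_map hb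
  -- The extra factor X makes n positive, so that bⁿ ≡ b modulo I below.
  let g := X * g'
  have hg : g.Monic := monic_X.mul hg'
  have hgb : aeval (b * b - b) g = 0 := by simp [g, hgb']
  let n := g.natDegree
  have hn : n ≠ 0 := by
    simp [n, g, natDegree_X_mul hg'.ne_zero]
  have hgI : g.map (Ideal.Quotient.mk I) = X ^ n := by
    have : g'.map (Ideal.Quotient.mk I) = X ^ g'.natDegree := by
      ext i
      rw [coeff_map, coeff_X_pow]
      split_ifs with hi
      · subst hi
        simp [hg'.coeff_natDegree]
      · exact Ideal.Quotient.eq_zero_iff_mem.mpr (hgI' i hi)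
    simp only [n, g, Polynomial.map_mul, map_X, this, natDegree_X_mul hg'.ne_zero, pow_succ']
  have hX2 : (X * X - X : A[X]).natDegree = 2 := by
    rw [show (X * X - X : A[X]) = X ^ 2 - X by ring]
    compute_degree!
  have hX2' : (X * X - X : A[X]).Monic := by
    rw [show (X * X - X : A[X]) = X ^ 2 - X by ring]
    monicity!
  have hf : (g.comp (X * X - X)).Monic := hg.comp hX2' (by rw [hX2]; simp)
  have hfn : (g.comp (X * X - X)).natDegree = n + n := by
    rw [natDegree_comp_eq_of_mul_ne_zero (by simp [hg.leadingCoeff, hX2'.leadingCoeff]), hX2, mul_two]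
  have hX1 : (X - 1 : (A ⧸ I)[X]).Monic := monic_X_sub_C 1
  -- The polynomial g(X² - X) kills b and reduces to Xⁿ(X - 1)ⁿ, a coprime factorization.
  obtain ⟨f₁, f₂, hf12, hf₁, hf₂⟩ := exists_factorization (I := I) (n := n + n) (m := n) (k := n) rfl
    (MonicDegreeEq.mk _ hf hfn) (MonicDegreeEq.mk (X ^ n) (monic_X_pow n) (natDegree_X_pow n))
    (MonicDegreeEq.mk ((X - 1) ^ n) (hX1.pow n)
      (by rw [hX1.natDegree_pow, show (X - 1 : (A ⧸ I)[X]) = X - C 1 by simp,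
            natDegree_X_sub_C, mul_one]))
    (by
      change X ^ n * (X - 1) ^ n = (g.comp (X * X - X)).map _
      rw [Polynomial.map_comp, hgI, ← mul_pow]
      simp [mul_sub])
    (by
      refine IsCoprime.pow ?_
      exact ⟨1, -1, by ring⟩)
  change f₁.1.map _ = X ^ n at hf₁
  change f₂.1.map _ = (X - 1) ^ n at hf₂
  change f₁.1 * f₂.1 = g.comp (X * X - X) at hf12
  -- Coprimality of monic polynomials means an invertible resultant, which can be checked modulo I.
  have hcop : IsCoprime f₁.1 f₂.1 := by
    rw [← isUnit_resultant_iff_isCoprime f₁.monic]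
    refine isUnit_of_isUnit_mk hI ?_
    rw [← resultant_map_map, ← f₁.monic.natDegree_map (Ideal.Quotient.mk I),
      ← f₂.monic.natDegree_map (Ideal.Quotient.mk I),
      isUnit_resultant_iff_isCoprime (f₁.monic.map _), hf₁, hf₂]
    refine IsCoprime.pow ?_
    exact ⟨1, -1, by ring⟩
  obtain ⟨u, v, huv⟩ := hcop
  have hb12 : aeval b f₁.1 * aeval b f₂.1 = 0 := by
    rw [← map_mul, hf12, aeval_comp]
    simpa using hgb
  have hbuv : aeval b u * aeval b f₁.1 + aeval b v * aeval b f₂.1 = 1 := by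
    rw [← map_mul, ← map_mul, ← map_add, huv, map_one]
  -- The Chinese remainder idempotent: f₁(b)f₂(b) = 0 and u(b)f₁(b) + v(b)f₂(b) = 1.
  refine ⟨aeval b u * aeval b f₁.1, ?_, ?_⟩
  · rw [IsIdempotentElem]
    linear_combination aeval b u * aeval b f₁.1 * hbuv - aeval b u * aeval b v * hb12
  · let m := Ideal.Quotient.mk (I.map (algebraMap A B))
    let ψ : A ⧸ I →+* B ⧸ I.map (algebraMap A B) := Ideal.quotientMap _ (algebraMap A B)
      Ideal.le_comap_map
    have hψ : m.comp (algebraMap A B) = ψ.comp (Ideal.Quotient.mk I) := by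
      ext x
      simp [m, ψ]
    have hm (p : A[X]) : m (aeval b p) = eval₂ ψ (m b) (p.map (Ideal.Quotient.mk I)) := by
      rw [Polynomial.aeval_def, Polynomial.hom_eval₂, hψ, ← Polynomial.eval₂_map]
    have hmb : m b * m b = m b := by
      rw [← map_mul]
      exact Ideal.Quotient.eq.mpr hb
    have h1 : m (aeval b f₁.1) = m b := by
      rw [hm, hf₁]
      simpa using IsIdempotentElem.pow_eq hmb hn
    have h2 : m b * m (aeval b f₂.1) = 0 := by
      rw [hm, hf₂]
      obtain ⟨k, hk⟩ := Nat.exists_eq_succ_of_ne_zero hn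
      simp only [eval₂_pow, eval₂_sub, eval₂_X, eval₂_one, hk]
      rw [Nat.succ_eq_add_one, pow_succ', ← mul_assoc, mul_sub, hmb, mul_one, sub_self, zero_mul]
    rw [← Ideal.Quotient.eq]
    change m _ = m _
    have h3 := congr_arg m hbuv
    simp only [map_add, map_mul, map_one, h1] at h3 ⊢
    linear_combination m b * h3 - m (aeval b u) * hmb - m (aeval b v) * h2

end IdempotentLifting

end TameRigidity

namespace TameRigidity

open TensorProduct

/-! ### Maps of finite étale algebras; splitting off the integral part of a quasi-finite algebra -/

section FiniteEtaleLifting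

/-- The separability element of B ⊗ B multiplies to 1 in B and annihilates 1 ⊗ s - s ⊗ 1. Its image
under f ⊗ g is congruent to 1 modulo the Jacobson radical, hence a unit, so every f(s) - g(s)
vanishes. This rigidity yields both the faithfulness of reduction and the unramifiedness of centred
valuations. -/
lemma algHom_eq_of_sub_mem_jacobson {A B C : Type*} [CommRing A] [CommRing B] [CommRing C]
    [Algebra A B] [Algebra A C] [Algebra.FormallyUnramified A B] [Algebra.EssFiniteType A B]
    (f g : B →ₐ[A] C) (h : ∀ b, f b - g b ∈ Ideal.jacobson (⊥ : Ideal C)) : f = g := by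
  let m : B ⊗[A] B →ₐ[A] C := Algebra.TensorProduct.lift f g (fun _ _ ↦ .all _ _)
  have hm (x : B ⊗[A] B) :
      m x - f (Algebra.TensorProduct.lmul' A x) ∈ Ideal.jacobson (⊥ : Ideal C) := by
    induction x with
    | zero => simp
    | tmul b c =>
      have := Ideal.mul_mem_left _ (-f b) (h c)
      convert! this using 1
      simp [m]
      ring
    | add x y hx hy =>
      have := add_mem hx hy
      convert! this using 1
      simp only [map_add]
      ring
  have hu : IsUnit (m (Algebra.FormallyUnramified.elem A B)) := by
    refine isUnit_of_sub_one_mem le_rfl ?_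
    have := hm (Algebra.FormallyUnramified.elem A B)
    rwa [Algebra.FormallyUnramified.lmul_elem, map_one] at this
  ext s
  have := congr_arg m (Algebra.FormallyUnramified.one_tmul_sub_tmul_one_mul_elem (R := A) s)
  rw [map_mul, map_zero, hu.mul_left_eq_zero] at this
  exact (sub_eq_zero.mp (by simpa [m] using this)).symm

variable {A : Type*} [CommRing A] [IsNoetherianRing A] {I : Ideal A} [HenselianRing A I]

/-- Homomorphisms of finite étale algebras lift along henselian pairs. -/
theorem exists_algHom_lift_of_finite_etale {B C : Type*} [CommRing B] [CommRing C]
    [Algebra A B] [Algebra A C] [Module.Finite A B] [Algebra.Etale A B] [Module.Finite A C]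
    (φ : B →ₐ[A] C ⧸ I.map (algebraMap A C)) :
    ∃ f : B →ₐ[A] C, ∀ b, Ideal.Quotient.mk _ (f b) = φ b := by
  have : IsNoetherianRing C := .of_finite A C
  let D := C ⊗[A] B
  have : IsNoetherianRing D := .of_finite C D
  have : Module.Finite A D := .trans C D
  let IC := I.map (algebraMap A C)
  have hID : IC.map (algebraMap C D) = I.map (algebraMap A D) := by
    rw [Ideal.map_map, ← IsScalarTower.algebraMap_eq]
  -- Maps B → C over A are sections of D over C, so φ becomes a section of the fibre of D to be
  -- lifted.
  let σ : D →ₐ[C] C ⧸ IC := Algebra.TensorProduct.lift (Algebra.ofId _ _) φ (fun _ _ ↦ .all _ _)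
  have : Algebra.Etale D (Localization.Away (1 : D)) := .of_isLocalizationAway 1
  have : Algebra.Etale C (Localization.Away (1 : D)) := .comp C D _
  have h1 : IsUnit (σ 1) := by simp
  obtain ⟨δ, hδ, h⟩ := exists_splitting_of_formallyUnramified σ 1 h1
  have hδ' : δ * δ - δ ∈ I.map (algebraMap A D) := by
    have := h (δ - 1) (by rw [map_sub, hδ, map_one, sub_self])
    rwa [hID, mul_sub, mul_one] at this
  -- The idempotent is lifted with D regarded as a finite A-algebra, which avoids proving that (C,
  -- IC) is henselian.
  obtain ⟨ε, hε, hεδ⟩ := exists_isIdempotentElem_sub_mem δ hδ'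
  rw [← hID] at hεδ
  have hIK : IC.map (algebraMap C D) ≤ RingHom.ker σ := by
    rw [Ideal.map_le_iff_le_comap]
    intro a ha
    rw [Ideal.mem_comap, RingHom.mem_ker, AlgHom.commutes]
    exact Ideal.Quotient.eq_zero_iff_mem.mpr ha
  obtain ⟨τ, hτ⟩ := exists_algHom_of_isIdempotentElem
    (map_le_jacobson_bot (HenselianRing.jac (I := I)) C) σ 1 h1 ε hε
    (by rw [← hδ, ← sub_eq_zero, ← map_sub]; exact hIK hεδ)
    (fun x hx ↦ by
      have := add_mem (h x hx) (Ideal.mul_mem_right x _ hεδ)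
      convert! this using 1
      ring)
  refine ⟨(τ.restrictScalars A).comp Algebra.TensorProduct.includeRight, fun b ↦ ?_⟩
  refine (hτ (1 ⊗ₜ b)).trans ?_
  refine (Algebra.TensorProduct.lift_tmul _ _ _ _ _).trans ?_
  rw [map_one, one_mul]

/-- A quasi-finite algebra over a henselian pair with integral fibre is integral up to a direct
factor with empty fibre. -/
theorem exists_isIdempotentElem_isIntegral {S : Type*} [CommRing S] [Algebra A S]
    [Algebra.FiniteType A S] [Algebra.QuasiFinite A S]
    [Algebra.IsIntegral A (S ⧸ I.map (algebraMap A S))] :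
    ∃ e : S, IsIdempotentElem e ∧ 1 - e ∈ I.map (algebraMap A S) ∧
      ∀ x : S, IsIntegral A (e * x) := by
  let C := integralClosure A S
  let den (x : S) : Ideal C :=
    (LinearMap.range (Algebra.linearMap C S)).comap (LinearMap.toSpanSingleton C S x)
  have hden (x : S) (c : C) : c ∈ den x ↔ IsIntegral A (c.1 * x) := by
    constructor
    · rintro ⟨y, hy⟩
      have : c.1 * x = y := hy.symm
      rw [this]
      exact y.2
    · intro h
      exact ⟨⟨_, h⟩, rfl⟩
  -- The elements c of the integral closure such that every x ∈ S becomes integral after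
  -- multiplication by a power of c: inverting c identifies C with S.
  let rr : Ideal C := ⨅ x, (den x).radical
  have hrr (c : C) : c ∈ rr ↔ ∀ x, ∃ m : ℕ, IsIntegral A (c.1 ^ m * x) := by
    simp only [rr, Ideal.mem_iInf, Ideal.mem_radical_iff, hden]
    rfl
  let kk : Ideal C := (I.map (algebraMap A S)).comap (algebraMap C S)
  let IC : Ideal C := I.map (algebraMap A C)
  have hICS {c : C} (hc : c ∈ IC) : c.1 ∈ I.map (algebraMap A S) := by
    have := Ideal.mem_map_of_mem (algebraMap C S) hc
    rwa [Ideal.map_map, ← IsScalarTower.algebraMap_eq] at this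
  -- A maximal ideal containing both would lie under a prime of S/IS, and Zariski's main theorem at
  -- that prime supplies an element of rr outside it.
  have htop : kk ⊔ rr = ⊤ := by
    by_contra hne
    obtain ⟨M, hM, hle⟩ := Ideal.exists_le_maximal _ hne
    have : Algebra.IsIntegral C (S ⧸ I.map (algebraMap A S)) := .tower_top A
    obtain ⟨Q, -, hQ, hQM⟩ := Ideal.exists_ideal_over_prime_of_isIntegral M
      (⊥ : Ideal (S ⧸ I.map (algebraMap A S))) (by
        refine le_trans (fun c hc ↦ ?_) (le_sup_left.trans hle)
        have h0 : Ideal.Quotient.mk (I.map (algebraMap A S)) c.1 = 0 := hc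
        have h1 : c.1 ∈ I.map (algebraMap A S) := Ideal.Quotient.eq_zero_iff_mem.mp h0
        exact h1)
    obtain ⟨r, hrp, hr, hr'⟩ := Algebra.zariskisMainProperty_iff.mp
      (Algebra.ZariskisMainProperty.of_finiteType (R := A)
        (Q.comap (Ideal.Quotient.mk (I.map (algebraMap A S)))))
    have h1 : (⟨r, hr⟩ : C) ∈ M := hle (Ideal.mem_sup_right ((hrr _).mpr hr'))
    rw [← hQM] at h1
    exact hrp h1
  obtain ⟨k, hk, r, hr, hkr⟩ := Submodule.mem_sup.mp ((Ideal.eq_top_iff_one _).mp htop)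
  -- Here k lies in IS ∩ C but perhaps not in IC; a power of r clears the non-integral coefficients.
  have hnil : ∃ m : ℕ, r ^ m * k ∈ IC := by
    have key : ∀ s ∈ I.map (algebraMap A S), ∃ m : ℕ, ∃ c ∈ IC, r.1 ^ m * s = c.1 := by
      intro s hs
      induction hs using Submodule.span_induction with
      | mem x hx =>
        obtain ⟨a, ha, rfl⟩ := hx
        exact ⟨0, algebraMap A C a, Ideal.mem_map_of_mem _ ha, by simp⟩
      | zero => exact ⟨0, 0, zero_mem _, by simp⟩
      | add x y _ _ hx hy =>
        obtain ⟨m, c, hc, hmc⟩ := hx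
        obtain ⟨n, d, hd, hnd⟩ := hy
        refine ⟨m + n, r ^ n * c + r ^ m * d, add_mem (Ideal.mul_mem_left _ _ hc)
          (Ideal.mul_mem_left _ _ hd), ?_⟩
        simp only [Subalgebra.coe_add, Subalgebra.coe_mul, Subalgebra.coe_pow, ← hmc, ← hnd]
        ring
      | smul b x _ hx =>
        obtain ⟨m, c, hc, hmc⟩ := hx
        obtain ⟨n, hn⟩ := (hrr r).mp hr b
        refine ⟨n + m, ⟨_, hn⟩ * c, Ideal.mul_mem_left _ _ hc, ?_⟩
        simp only [Subalgebra.coe_mul, ← hmc, smul_eq_mul]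
        ring
    obtain ⟨m, c, hc, hmc⟩ := key k.1 hk
    refine ⟨m, ?_⟩
    convert! hc
    exact Subtype.ext hmc
  obtain ⟨m, hm⟩ := hnil
  -- The exponent m + 1 makes the product of the two terms of the Bézout identity divisible by r^m k
  -- ∈ IC, so v r^(m + 1) is idempotent modulo IC.
  have hcop : IsCoprime (k ^ (m + 1)) (r ^ (m + 1)) := IsCoprime.pow ⟨1, 1, by simpa using hkr⟩
  obtain ⟨u, v, huv⟩ := hcop
  have hmem : (v * r ^ (m + 1)) * (v * r ^ (m + 1)) - v * r ^ (m + 1) ∈ IC := by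
    have := Ideal.mul_mem_left IC (- u * v * r * k ^ m) hm
    convert! this using 1
    rw [← sub_eq_zero]
    linear_combination (v * r ^ (m + 1)) * huv
  obtain ⟨e, he, heR⟩ := exists_isIdempotentElem_sub_mem _ hmem
  have hjac : IC ≤ Ideal.jacobson ⊥ := map_le_jacobson_bot (HenselianRing.jac (I := I)) C
  -- Modulo IC the idempotent e equals a multiple of r. Multiplying e by a unit of the form 1 -
  -- (element of IC) turns this into honest divisibility.
  have herr : e ∈ rr := by
    have hu : IsUnit (1 - (e - v * r ^ (m + 1))) :=
      isUnit_of_sub_one_mem hjac (by simpa using neg_mem heR)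
    have h1 : e * (1 - (e - v * r ^ (m + 1))) = e * v * r ^ m * r := by
      have := he.eq
      linear_combination - this
    have h2 : e * (1 - (e - v * r ^ (m + 1))) ∈ rr := by
      rw [h1]
      exact Ideal.mul_mem_left _ _ hr
    exact (Ideal.mul_unit_mem_iff_mem _ hu).mp h2
  refine ⟨e.1, congr_arg Subtype.val he.eq, ?_, fun x ↦ ?_⟩
  · have h1 : (1 : S) - e.1 = ((u * k ^ m * k : C) : S) - ((e - v * r ^ (m + 1) : C) : S) := by
      rw [← Subalgebra.coe_sub, ← Subalgebra.coe_one C, ← Subalgebra.coe_sub]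
      congr 1
      linear_combination - huv
    rw [h1]
    exact sub_mem (Ideal.mul_mem_left kk _ hk) (hICS heR)
  · obtain ⟨n, hn⟩ := (hrr e).mp herr x
    have h1 : e.1 ^ n * (e.1 * x) = e.1 * x := by
      have he' : e.1 * e.1 = e.1 := congr_arg Subtype.val he.eq
      rw [← mul_assoc, ← pow_succ, IsIdempotentElem.pow_succ_eq n he']
    rw [← h1, mul_left_comm]
    exact IsIntegral.mul e.2 hn

end FiniteEtaleLifting

/-! ### Lifting étale and finite étale algebras from A/I to A -/

section EtaleLifting

open MvPolynomial Algebra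

/-- Étale algebras lift along quotient maps. -/
theorem exists_etale_lift {A : Type u} [CommRing A] {I : Ideal A} {B₀ : Type u} [CommRing B₀]
    [Algebra A B₀] [Algebra (A ⧸ I) B₀] [IsScalarTower A (A ⧸ I) B₀] [Algebra.Etale (A ⧸ I) B₀] :
    ∃ (S : Type u) (_ : CommRing S) (_ : Algebra A S) (_ : Algebra.Etale A S) (q : S →ₐ[A] B₀),
      Function.Surjective q ∧ RingHom.ker q = I.map (algebraMap A S) := by
  classical
  obtain ⟨ι, σ, _, _, P, hP⟩ :=
    ((Etale.iff_isStandardSmoothOfRelativeDimension_zero (R := A ⧸ I) (S := B₀)).mp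
      inferInstance).out
  cases nonempty_fintype σ
  have hmapsurj : Function.Surjective (MvPolynomial.map (σ := ι) (Ideal.Quotient.mk I)) :=
    MvPolynomial.map_surjective _ Ideal.Quotient.mk_surjective
  -- A square presentation of B₀ is lifted by lifting its relations arbitrarily; the Jacobian stays
  -- invertible along the fibre.
  choose v hv using fun i ↦ hmapsurj (P.relation i)
  let E := MvPolynomial ι A ⧸ Ideal.span (Set.range v)
  let Q : PreSubmersivePresentation A E ι σ :=
    { Presentation.naive (v := v) with
      map := P.map
      map_inj := P.map_inj }
  let p : MvPolynomial ι A →ₐ[A] B₀ := aeval P.val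
  have hp (x : MvPolynomial ι A) : p x = aeval P.val (MvPolynomial.map (Ideal.Quotient.mk I) x) := by
    exact (MvPolynomial.aeval_map_algebraMap (A ⧸ I) P.val x).symm
  have hpv : ∀ x ∈ Ideal.span (Set.range v), p x = 0 := by
    intro x hx
    have : Ideal.span (Set.range v) ≤ RingHom.ker p := by
      rw [Ideal.span_le]
      rintro _ ⟨i, rfl⟩
      change p (v i) = 0
      rw [hp, hv, P.aeval_val_relation]
    exact this hx
  let q₀ : E →ₐ[A] B₀ := Ideal.Quotient.liftₐ _ p hpv
  have hq₀ (x) : q₀ (Ideal.Quotient.mk _ x) = p x := rfl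
  let Δ : E := Q.jacobian
  have hΔ : q₀ Δ = P.jacobian := by
    simp only [Δ]
    rw [PreSubmersivePresentation.jacobian_eq_jacobiMatrix_det,
      PreSubmersivePresentation.jacobian_eq_jacobiMatrix_det]
    change p (Q.jacobiMatrix.det) = _
    rw [hp, P.algebraMap_apply, RingHom.map_det]
    congr 2
    ext1 i j
    rw [RingHom.mapMatrix_apply, Matrix.map_apply, PreSubmersivePresentation.jacobiMatrix_apply,
      PreSubmersivePresentation.jacobiMatrix_apply, ← hv j, MvPolynomial.pderiv_map]
    rfl
  -- Inverting the Jacobian makes the lift étale and leaves the fibre unchanged, since Δ maps to a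
  -- unit of B₀.
  let S := Localization.Away Δ
  let F : SubmersivePresentation A S _ _ :=
    { toPreSubmersivePresentation := .comp (.localizationAway S Δ) Q
      jacobian_isUnit := by
        have hu : IsUnit (algebraMap E S Δ) := IsLocalization.Away.algebraMap_isUnit _
        have hu' : IsUnit (algebraMap E S Q.jacobian) := hu
        simp [Algebra.smul_def, -isUnit_map_iff, hu, hu'] }
  have hdim : Q.dimension = 0 := hP
  have : Algebra.IsStandardSmoothOfRelativeDimension 0 A S :=
    ⟨_, _, _, inferInstance, F, by
      simp only [Algebra.PreSubmersivePresentation.dimension_comp_eq_dimension_add_dimension, F]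
      rw [hdim, add_zero]
      exact Presentation.localizationAway_dimension_zero Δ⟩
  have hu : IsUnit (q₀ Δ) := hΔ ▸ P.jacobian_isUnit
  let q : S →ₐ[A] B₀ := IsLocalization.liftAlgHom (M := .powers Δ) (f := q₀)
    (by rintro ⟨_, n, rfl⟩; simpa only [map_pow] using hu.pow n)
  have hq (x : E) : q (algebraMap E S x) = q₀ x := IsLocalization.lift_eq _ _
  refine ⟨S, inferInstance, inferInstance, inferInstance, q, fun b ↦ ?_, le_antisymm ?_ ?_⟩
  · obtain ⟨x, rfl⟩ := P.aeval_val_surjective b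
    obtain ⟨x, rfl⟩ := hmapsurj x
    exact ⟨algebraMap E S (Ideal.Quotient.mk _ x), by rw [hq, hq₀, hp]⟩
  · intro s hs
    obtain ⟨n, x, hx⟩ := IsLocalization.Away.surj Δ s
    obtain ⟨x, rfl⟩ := Ideal.Quotient.mk_surjective x
    have hx0 : p x = 0 := by
      rw [← hq₀, ← hq, ← hx, map_mul, show q s = 0 from hs, zero_mul]
    rw [hp, ← RingHom.mem_ker, ← P.ker_eq_ker_aeval_val, ← P.span_range_relation_eq_ker] at hx0
    have hxI : x ∈ I.map MvPolynomial.C ⊔ Ideal.span (Set.range v) := by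
      have h1 : Ideal.span (Set.range P.relation) =
          (Ideal.span (Set.range v)).map (MvPolynomial.map (Ideal.Quotient.mk I)) := by
        rw [Ideal.map_span, ← Set.range_comp]
        congr 2
        ext1 i
        exact (hv i).symm
      rw [h1] at hx0
      have h2 := (Ideal.mem_comap.mpr hx0 : x ∈ Ideal.comap _ _)
      rw [Ideal.comap_map_of_surjective _ hmapsurj, ← RingHom.ker_eq_comap_bot,
        MvPolynomial.ker_map, Ideal.mk_ker, sup_comm] at h2
      exact h2
    have hxE : algebraMap E S (Ideal.Quotient.mk _ x) ∈ I.map (algebraMap A S) := by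
      obtain ⟨y, hy, z, hz, rfl⟩ := Submodule.mem_sup.mp hxI
      rw [map_add, Ideal.Quotient.eq_zero_iff_mem.mpr hz, add_zero]
      have := Ideal.mem_map_of_mem ((algebraMap E S).comp (Ideal.Quotient.mk _)) hy
      rwa [Ideal.map_map] at this
    rw [← hx] at hxE
    have hu' : IsUnit (algebraMap E S Δ ^ n) := (IsLocalization.Away.algebraMap_isUnit Δ).pow n
    exact (Ideal.mul_unit_mem_iff_mem _ hu').mp hxE
  · rw [Ideal.map_le_iff_le_comap]
    intro a ha
    rw [Ideal.mem_comap, RingHom.mem_ker]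
    change q (algebraMap A S a) = 0
    rw [AlgHom.commutes, IsScalarTower.algebraMap_apply A (A ⧸ I) B₀]
    change algebraMap _ _ (Ideal.Quotient.mk I a) = 0
    rw [Ideal.Quotient.eq_zero_iff_mem.mpr ha, map_zero]

/-- Finite étale algebras lift along henselian pairs. -/
theorem exists_finite_etale_lift {A : Type u} [CommRing A] [IsNoetherianRing A] {I : Ideal A}
    [HenselianRing A I] {B₀ : Type u} [CommRing B₀]
    [Algebra A B₀] [Algebra (A ⧸ I) B₀] [IsScalarTower A (A ⧸ I) B₀] [Algebra.Etale (A ⧸ I) B₀]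
    [Module.Finite (A ⧸ I) B₀] :
    ∃ (B : Type u) (_ : CommRing B) (_ : Algebra A B) (_ : Algebra.Etale A B)
      (_ : Module.Finite A B) (q : B →ₐ[A] B₀),
      Function.Surjective q ∧ RingHom.ker q = I.map (algebraMap A B) := by
  obtain ⟨S, _, _, _, q, hq, hker⟩ := exists_etale_lift (I := I) (B₀ := B₀)
  have : Module.Finite A B₀ := .trans (A ⧸ I) B₀
  have e : (S ⧸ I.map (algebraMap A S)) ≃ₐ[A] B₀ :=
    (Ideal.quotientEquivAlgOfEq A hker.symm).trans (Ideal.quotientKerAlgEquivOfSurjective hq)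
  have : Module.Finite A (S ⧸ I.map (algebraMap A S)) := .equiv e.symm.toLinearEquiv
  -- S need not be finite, but its factor eS is integral and, as 1 - e ∈ IS, has the same fibre
  -- modulo I.
  obtain ⟨e, he, heI, hint⟩ := exists_isIdempotentElem_isIntegral (A := A) (I := I) (S := S)
  let B := S ⧸ Ideal.span {1 - e}
  have : IsLocalization.Away e B := IsLocalization.Away.quotient_of_isIdempotentElem he
  have : Algebra.Etale S B := .of_isLocalizationAway e
  have : Algebra.Etale A B := .comp A S B
  let m : S →ₐ[A] B := Ideal.Quotient.mkₐ A _
  have hm : Function.Surjective m := Ideal.Quotient.mk_surjective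
  have : Algebra.IsIntegral A B := by
    refine ⟨fun y ↦ ?_⟩
    obtain ⟨x, rfl⟩ := hm y
    have h1 : m x = m (e * x) := by
      refine Ideal.Quotient.eq.mpr ?_
      exact Ideal.mem_span_singleton'.mpr ⟨x, by ring⟩
    rw [h1]
    exact (hint x).map m
  have : Module.Finite A B := Algebra.IsIntegral.finite
  have hqe : ∀ x ∈ Ideal.span {1 - e}, q x = 0 := by
    intro x hx
    have : Ideal.span {1 - e} ≤ RingHom.ker q := by
      rw [Ideal.span_singleton_le_iff_mem, hker]
      exact heI
    exact this hx
  let qB : B →ₐ[A] B₀ := Ideal.Quotient.liftₐ _ q hqe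
  refine ⟨B, inferInstance, inferInstance, inferInstance, inferInstance, qB,
    fun b ↦ ?_, le_antisymm ?_ ?_⟩
  · obtain ⟨s, rfl⟩ := hq b
    exact ⟨m s, rfl⟩
  · intro y hy
    obtain ⟨x, rfl⟩ := hm y
    have hx : x ∈ I.map (algebraMap A S) := by
      rw [← hker]
      exact hy
    have := Ideal.mem_map_of_mem (m : S →+* B) hx
    rwa [Ideal.map_map, show (m : S →+* B).comp (algebraMap A S) = algebraMap A B from
      m.comp_algebraMap] at this
  · rw [Ideal.map_le_iff_le_comap]
    intro a ha
    rw [Ideal.mem_comap, RingHom.mem_ker]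
    change qB (algebraMap A B a) = 0
    rw [AlgHom.commutes, IsScalarTower.algebraMap_apply A (A ⧸ I) B₀]
    change algebraMap _ _ (Ideal.Quotient.mk I a) = 0
    rw [Ideal.Quotient.eq_zero_iff_mem.mpr ha, map_zero]

end EtaleLifting

end TameRigidity

namespace TameRigidity

open Polynomial

/-! ### Integrality of A over R away from π = 0 -/

section Integrality

/-- Such a y would be integral over the polynomial ring, hence a polynomial divisible by X, and then
X^m would divide X^d with d < m. -/
lemma pow_ne_algebraMap_X_pow {k σ : Type*} [Field k] (i : σ) {d m : ℕ} (hd : 0 < d)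
    (hm : d < m) (y : FractionRing (MvPolynomial σ k)) :
    y ^ m ≠ algebraMap (MvPolynomial σ k) _ (MvPolynomial.X i) ^ d := by
  intro h
  have hy : IsIntegral (MvPolynomial σ k) y := by
    refine IsIntegral.of_pow (by omega : 0 < m) ?_
    rw [h]
    exact (isIntegral_algebraMap).pow d
  obtain ⟨p, rfl⟩ := IsIntegrallyClosed.isIntegral_iff.mp hy
  rw [← map_pow, ← map_pow] at h
  replace h := IsFractionRing.injective _ _ h
  have hX : Prime (MvPolynomial.X i : MvPolynomial σ k) := MvPolynomial.X_prime
  have h1 : MvPolynomial.X i ∣ p := hX.dvd_of_dvd_pow (n := m) (h ▸ dvd_pow_self _ hd.ne')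
  have h2 := pow_dvd_pow_of_dvd h1 m
  rw [h] at h2
  exact absurd ((pow_dvd_pow_iff hX.ne_zero hX.not_isUnit).mp h2) (by omega)

/-- A transcendental t extends to a transcendence basis, over whose rational function field E the
field F is finite. Taking norms of the roots of t bounds their order against the degree of F over E.
-/
lemma isAlgebraic_of_forall_exists_pow_eq {k F : Type*} [Field k] [Field F] [Algebra k F]
    [Algebra.EssFiniteType k F] {l : ℕ} (hl : 1 < l) (t : F) (h : ∀ n, ∃ x : F, x ^ l ^ n = t) :
    IsAlgebraic k t := by
  by_contra ht
  have ht' : AlgebraicIndepOn k id ({t} : Set F) := by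
    exact algebraicIndependent_unique_type_iff.mpr ht
  obtain ⟨s, hts, hs⟩ := exists_isTranscendenceBasis_superset ht'
  let E := IntermediateField.adjoin k (Set.range ((↑) : s → F))
  have halg : Algebra.IsAlgebraic E F := hs.isAlgebraic_field
  have : Algebra.EssFiniteType E F := Algebra.EssFiniteType.of_comp k E F
  have : Module.Finite E F := Algebra.finite_of_essFiniteType_of_isAlgebraic
  let i : s := ⟨t, hts rfl⟩
  let e : FractionRing (MvPolynomial s k) ≃ₐ[k] E := hs.1.aevalEquivField
  have hi : e (algebraMap (MvPolynomial s k) _ (MvPolynomial.X i)) =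
      (⟨t, IntermediateField.subset_adjoin _ _ ⟨i, rfl⟩⟩ : E) := by
    apply Subtype.ext
    rw [hs.1.aevalEquivField_algebraMap_apply_coe]
    simp [i]
  -- With d = [F : E] and n = d, the norm y of x satisfies y^(l^d) = t^d, and d < l^d.
  obtain ⟨x, hx⟩ := h (Module.finrank E F)
  have h1 := congrArg (fun z ↦ e.symm (Algebra.norm E z)) hx
  have h2 : Algebra.norm E t =
      (⟨t, IntermediateField.subset_adjoin _ _ ⟨i, rfl⟩⟩ : E) ^ Module.finrank E F :=
    Algebra.norm_algebraMap (⟨t, IntermediateField.subset_adjoin _ _ ⟨i, rfl⟩⟩ : E)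
  simp only [map_pow] at h1
  rw [h2, ← hi, map_pow, e.symm_apply_apply] at h1
  exact pow_ne_algebraMap_X_pow i Module.finrank_pos (Nat.lt_pow_self hl) _ h1

lemma exists_primitive_aeval_eq_zero {R D : Type*} [CommRing R] [IsDomain R]
    [IsDiscreteValuationRing R] [CommRing D] [IsDomain D] [Algebra R D] [FaithfulSMul R D]
    {d : D} (hd : IsAlgebraic R d) : ∃ f : R[X], f.IsPrimitive ∧ aeval d f = 0 := by
  classical
  let := (UniqueFactorizationMonoid.toGCDMonoid R)
  let : NormalizedGCDMonoid R := Classical.choice inferInstance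
  obtain ⟨f, hf, h⟩ := hd
  refine ⟨f.primPart, f.isPrimitive_primPart, ?_⟩
  exact (Polynomial.aeval_primPart_eq_zero hf h)

/-- A primitive equation for d stays nonzero modulo the maximal ideal, so R[d] is quasi-finite over
R with integral special fibre. Henselianity splits off an integral factor; R[d] is a domain, so this
factor is zero or everything, and `hJ` excludes zero because it makes the special fibre nonempty. -/
lemma isIntegral_of_isAlgebraic_of_henselian {R D : Type*} [CommRing R] [IsDomain R]
    [IsDiscreteValuationRing R] [HenselianLocalRing R] [CommRing D] [IsDomain D] [Algebra R D]
    [FaithfulSMul R D]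
    (hJ : (IsLocalRing.maximalIdeal R).map (algebraMap R D) ≠ ⊤)
    {d : D} (hd : IsAlgebraic R d) : IsIntegral R d := by
  obtain ⟨f, hf, hfd⟩ := exists_primitive_aeval_eq_zero hd
  let S := Algebra.adjoin R {d}
  let dS : S := ⟨d, Algebra.self_mem_adjoin_singleton R d⟩
  have hS : Algebra.adjoin R {dS} = ⊤ := by
    have := Algebra.adjoin_adjoin_coe_preimage (R := R) (s := ({d} : Set D))
    convert this using 2
    ext x
    simp [dS, Subtype.ext_iff]
  have hfS : aeval dS f = 0 := by
    apply Subtype.ext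
    have := Polynomial.aeval_algebraMap_apply D dS f
    rw [show algebraMap S D dS = d from rfl, hfd] at this
    exact this.symm
  have hft : Algebra.FiniteType R S := by
    refine ⟨⟨{dS}, ?_⟩⟩
    simpa using hS
  let m := IsLocalRing.maximalIdeal R
  let J := m.map (algebraMap R S)
  have hmJ : Algebra.IsIntegral R (S ⧸ J) := by
    let := Ideal.Quotient.field m
    have hd0 : IsIntegral R (Ideal.Quotient.mk J dS) := by
      have h1 : IsAlgebraic (R ⧸ m) (Ideal.Quotient.mk J dS) := by
        refine ⟨f.map (Ideal.Quotient.mk m), fun h0 ↦ ?_, ?_⟩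
        · obtain ⟨ϖ, hϖ⟩ := IsDiscreteValuationRing.exists_irreducible R
          have h3 : Polynomial.C ϖ ∣ f := by
            rw [Polynomial.C_dvd_iff_dvd_coeff]
            intro i
            rw [← Ideal.mem_span_singleton, ← hϖ.maximalIdeal_eq,
              ← Ideal.Quotient.eq_zero_iff_mem, ← Polynomial.coeff_map, h0, Polynomial.coeff_zero]
          exact hϖ.not_isUnit (hf ϖ h3)
        · rw [show Ideal.Quotient.mk m = algebraMap R (R ⧸ m) from rfl,
            Polynomial.aeval_map_algebraMap]
          change aeval (algebraMap S (S ⧸ J) dS) f = 0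
          rw [Polynomial.aeval_algebraMap_apply, hfS, map_zero]
      have : Algebra.IsIntegral R (R ⧸ m) := inferInstance
      exact isIntegral_trans _ h1.isIntegral
    refine ⟨fun x ↦ ?_⟩
    obtain ⟨x, rfl⟩ := Ideal.Quotient.mk_surjective x
    have h1 : (⊤ : Subalgebra R S) ≤
        (integralClosure R (S ⧸ J)).comap (Ideal.Quotient.mkₐ R J) := by
      rw [← hS]
      exact Algebra.adjoin_le (Set.singleton_subset_iff.mpr hd0)
    exact h1 (Algebra.mem_top (x := x))
  have hfin : Module.Finite R (S ⧸ J) := Algebra.IsIntegral.finite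
  have hqf : Algebra.QuasiFinite R S := by
    rw [Algebra.QuasiFinite.iff_finite_comap_preimage_singleton]
    intro x
    -- Over the generic point only the zero prime occurs, since a nonzero algebraic element of a
    -- prime gives a nonzero element of its contraction. Primes over the closed point come from the
    -- finite special fibre.
    by_cases hx : x.asIdeal = ⊥
    · refine (Set.finite_singleton (⊥ : PrimeSpectrum S)).subset fun y hy ↦ ?_
      have hy' : y.asIdeal.comap (algebraMap R S) = ⊥ := by
        rw [← hx, ← (show PrimeSpectrum.comap (algebraMap R S) y = x from hy)]; rfl
      refine PrimeSpectrum.ext ?_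
      by_contra hne
      obtain ⟨z, hz, hz0⟩ := Submodule.exists_mem_ne_zero_of_ne_bot hne
      have hzalg : IsAlgebraic R z := by
        have h1 : S ≤ Subalgebra.algebraicClosure R D :=
          Algebra.adjoin_le (Set.singleton_subset_iff.mpr hd)
        exact (isAlgebraic_algebraMap_iff (A := D) Subtype.val_injective).mp (h1 z.2)
      exact Ideal.comap_ne_bot_of_algebraic_mem hz0 hz hzalg hy'
    · have hxm : x.asIdeal = m :=
        IsLocalRing.eq_maximalIdeal (Ring.DimensionLEOne.maximalOfPrime hx x.isPrime)
      have hfs := (Algebra.QuasiFinite.finite_comap_preimage_singleton (S := S ⧸ J) x).image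
        (PrimeSpectrum.comap (Ideal.Quotient.mk J))
      refine hfs.subset fun y hy ↦ ?_
      have hJy : J ≤ y.asIdeal := by
        rw [Ideal.map_le_iff_le_comap, ← hxm,
          ← (show PrimeSpectrum.comap (algebraMap R S) y = x from hy)]; exact le_rfl
      have hr : y ∈ Set.range (PrimeSpectrum.comap (Ideal.Quotient.mk J)) := by
        rw [range_comap_of_surjective _ _ Ideal.Quotient.mk_surjective, 
          Ideal.mk_ker]
        exact hJy
      obtain ⟨z, rfl⟩ := hr
      exact ⟨z, hy, rfl⟩
  obtain ⟨e, he, he1, hint⟩ := exists_isIdempotentElem_isIntegral (A := R) (S := S) (I := m)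
  rcases IsIdempotentElem.iff_eq_zero_or_one.mp he with rfl | rfl
  · refine absurd ?_ hJ
    rw [sub_zero] at he1
    have := Ideal.mem_map_of_mem S.val.toRingHom he1
    rw [Ideal.map_map] at this
    rw [Ideal.eq_top_iff_one]
    simpa using this
  · have := hint dS
    rw [one_mul] at this
    exact this.map S.val

lemma injective_algebraMap_of_irreducible_not_mem {R D : Type*} [CommRing R] [IsDomain R]
    [IsDiscreteValuationRing R] [CommRing D] [IsDomain D] (i : R →+* D) {π : R}
    (hπ : Irreducible π) (h : i π ≠ 0) : Function.Injective i := by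
  rw [injective_iff_map_eq_zero]
  intro x hx
  by_contra hx0
  obtain ⟨n, u, rfl⟩ := IsDiscreteValuationRing.eq_unit_mul_pow_irreducible hx0 hπ
  rw [map_mul, map_pow] at hx
  exact mul_ne_zero (u.isUnit.map i).ne_zero (pow_ne_zero n h) hx

/-- Over a henselian discrete valuation ring `R`, an algebra essentially of finite type which is
henselian along a uniformizer has integral image in every field where the uniformizer is
invertible. -/
lemma isIntegralElem_of_map_ne_zero {R A K : Type*} [CommRing R] [IsDomain R]
    [IsDiscreteValuationRing R] [HenselianLocalRing R] [CommRing A] [Algebra R A]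
    [Algebra.EssFiniteType R A] {π : R} (hπ : Irreducible π) {I : Ideal A}
    (hI : I = Ideal.span {algebraMap R A π}) [HenselianRing A I] [Field K] (ρ : A →+* K)
    (hρ : ρ (algebraMap R A π) ≠ 0) (a : A) :
    (ρ.comp (algebraMap R A)).IsIntegralElem (ρ a) := by
  let D := A ⧸ RingHom.ker ρ
  have hker : (RingHom.ker ρ).IsPrime := RingHom.ker_isPrime ρ
  let F := FractionRing D
  let k := FractionRing R
  have hπD : algebraMap R D π ≠ 0 := fun h ↦ hρ (Ideal.Quotient.eq_zero_iff_mem.mp h)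
  have hinj := injective_algebraMap_of_irreducible_not_mem (algebraMap R D) hπ hπD
  have : FaithfulSMul R D := (faithfulSMul_iff_algebraMap_injective R D).mpr hinj
  have : FaithfulSMul R F := inferInstance
  let : Algebra k F := FractionRing.liftAlgebra R F
  have : IsScalarTower R k F := FractionRing.isScalarTower_liftAlgebra R F
  have : Algebra.EssFiniteType R D := Algebra.EssFiniteType.comp R A D
  have : Algebra.EssFiniteType D F := Algebra.EssFiniteType.of_isLocalization _ (nonZeroDivisors D)
  have : Algebra.EssFiniteType R F := Algebra.EssFiniteType.comp R D F
  have : Algebra.EssFiniteType k F := Algebra.EssFiniteType.of_comp R k F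
  -- Since 3 - 2 = 1, one of 2 and 3 is a unit of the local ring R.
  have hl : ∃ l : ℕ, 1 < l ∧ IsUnit (l : R) := by
    rcases IsLocalRing.isUnit_or_isUnit_of_add_one (a := (3 : R)) (b := -2) (by ring) with h | h
    · exact ⟨3, by norm_num, by exact_mod_cast h⟩
    · exact ⟨2, by norm_num, by simpa using h⟩
  obtain ⟨l, hl1, hl⟩ := hl
  let d : D := Ideal.Quotient.mk _ a
  -- Modulo I the equation has the root 1, simple because its derivative there is the unit l^n.
  have hroot (n : ℕ) : ∃ x : A, x ^ l ^ n = 1 + algebraMap R A π * a := by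
    have hmon : (Polynomial.X ^ l ^ n - Polynomial.C (1 + algebraMap R A π * a)).Monic :=
      Polynomial.monic_X_pow_sub_C _ (by positivity)
    obtain ⟨x, hx, -⟩ := HenselianRing.is_henselian (I := I) _ hmon 1
      (by
        rw [hI, Ideal.mem_span_singleton]
        exact ⟨-a, by simp⟩)
      (by
        refine IsUnit.map _ ?_
        have := (hl.pow n).map (algebraMap R A)
        simpa [Polynomial.derivative_X_pow] using this)
    refine ⟨x, ?_⟩
    simpa [sub_eq_zero] using hx
  have halg : IsAlgebraic k (algebraMap D F (1 + algebraMap R D π * d)) := by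
    refine isAlgebraic_of_forall_exists_pow_eq hl1 _ fun n ↦ ?_
    obtain ⟨x, hx⟩ := hroot n
    refine ⟨algebraMap D F (Ideal.Quotient.mk _ x), ?_⟩
    rw [← map_pow, ← map_pow, hx]
    rw [map_add, map_mul, map_one]
    rfl
  have hd : IsAlgebraic R d := by
    rw [← isAlgebraic_algebraMap_iff (IsFractionRing.injective D F), 
      IsFractionRing.isAlgebraic_iff R k F]
    have h1 : algebraMap D F d = (algebraMap D F (1 + algebraMap R D π * d) - 1) *
        algebraMap k F (algebraMap R k π)⁻¹ := by
      have h2 : algebraMap D F (algebraMap R D π) ≠ 0 := by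
        simpa using hπD
      rw [map_inv₀, ← IsScalarTower.algebraMap_apply, IsScalarTower.algebraMap_apply R D F]
      rw [map_add, map_one, add_sub_cancel_left, map_mul, mul_comm, inv_mul_cancel_left₀ h2]
    rw [h1]
    exact (halg.sub isAlgebraic_one).mul (isAlgebraic_algebraMap _)
  -- If π were invertible in D, some 1 - πz would lie in ker ρ; but it is a unit of A, as π is in
  -- the Jacobson radical.
  have hint : IsIntegral R d := by
    refine isIntegral_of_isAlgebraic_of_henselian (fun h ↦ ?_) hd
    rw [hπ.maximalIdeal_eq, Ideal.map_span, Set.image_singleton] at h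
    obtain ⟨z, hz⟩ := (Ideal.span_singleton_eq_top.mp h).exists_right_inv
    obtain ⟨z, rfl⟩ := Ideal.Quotient.mk_surjective z
    have h1 : algebraMap R A π * z ∈ Ideal.jacobson ⊥ := by
      refine HenselianRing.jac (I := I) ?_
      rw [hI]
      exact Ideal.mul_mem_right _ _ (Ideal.mem_span_singleton_self _)
    have h2 := Ideal.mem_jacobson_bot.mp h1 (-1)
    have h3 : (algebraMap R A π * z) * -1 + 1 ∈ RingHom.ker ρ := by
      rw [← Ideal.Quotient.eq_zero_iff_mem]
      change (Ideal.Quotient.mk _ (algebraMap R A π * z * -1 + 1) : D) = 0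
      rw [map_add, map_mul, map_mul, map_neg, map_one]
      rw [show (Ideal.Quotient.mk (RingHom.ker ρ)) (algebraMap R A π) = algebraMap R D π from rfl,
        hz]
      ring
    exact hker.ne_top (Ideal.eq_top_of_isUnit_mem _ h3 h2)
  obtain ⟨p, hp, h⟩ := hint
  refine ⟨p, hp, ?_⟩
  have := congrArg (Ideal.Quotient.lift (RingHom.ker ρ) ρ fun _ h ↦ h) h
  rw [Polynomial.hom_eval₂, map_zero] at this
  exact this

end Integrality

end TameRigidity

namespace TameRigidity

/-! ### Tame ramification through inertial automorphisms -/

section TameAlgebra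

open scoped Pointwise

/-- An endomorphism `σ` preserves the valuation ring `W` and acts trivially on its residue
field. -/
def IsInertial {Ω : Type*} [Field Ω] (W : ValuationSubring Ω) (σ : Ω → Ω) : Prop :=
  ∀ x ∈ W, σ x ∈ W ∧ W.valuation (σ x - x) < 1

/-- Expressing inertia by a condition on functions Ω → Ω removes the base field from it, which makes
the inertia groups over different base fields comparable. -/
lemma mem_strictHenselization_iff {K Ω : Type u} [Field K] [Field Ω] [Algebra K Ω]
    {W : ValuationSubring Ω} {z : Ω} :
    z ∈ strictHenselization K W ↔ ∀ σ : Ω ≃ₐ[K] Ω, IsInertial W σ → IsInertial W σ.symm →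
      σ z = z := by
  have key (σ : Ω ≃ₐ[K] Ω) : σ ∈ (W.inertiaSubgroup K).map (W.decompositionSubgroup K).subtype ↔
      IsInertial W σ ∧ IsInertial W σ.symm := by
    have hval (σ : Ω ≃ₐ[K] Ω) (hσ : σ ∈ W.decompositionSubgroup K) (x : W) :
        MulSemiringAction.toRingAut (W.decompositionSubgroup K) (IsLocalRing.ResidueField W)
          ⟨σ, hσ⟩ (IsLocalRing.residue W x) = IsLocalRing.residue W x ↔
          W.valuation (σ x - x) < 1 := by
      change IsLocalRing.residue W ((⟨σ, hσ⟩ : W.decompositionSubgroup K) • x) = _ ↔ _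
      rw [← sub_eq_zero, ← map_sub, IsLocalRing.residue_eq_zero_iff,
        ValuationSubring.valuation_lt_one_iff]
      rfl
    constructor
    · have aux (σ : W.decompositionSubgroup K) (h : σ ∈ W.inertiaSubgroup K) :
          IsInertial W σ.1 := fun x hx ↦ by
        refine ⟨(σ • (⟨x, hx⟩ : W)).2, (hval σ.1 σ.2 ⟨x, hx⟩).mp ?_⟩
        exact DFunLike.congr_fun ((MonoidHom.mem_ker).mp h) (IsLocalRing.residue W ⟨x, hx⟩)
      rintro ⟨σ, h, rfl⟩
      exact ⟨aux σ h, aux σ⁻¹ (inv_mem h)⟩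
    · rintro ⟨h1, h2⟩
      have hσ : σ ∈ W.decompositionSubgroup K := by
        rw [MulAction.mem_stabilizer_iff]
        ext x
        rw [ValuationSubring.mem_pointwise_smul_iff_inv_smul_mem]
        refine ⟨fun hx ↦ ?_, fun hx ↦ (h2 x hx).1⟩
        have := (h1 _ hx).1
        rwa [show σ (σ⁻¹ • x) = x from smul_inv_smul σ x] at this
      refine ⟨⟨σ, hσ⟩, ?_, rfl⟩
      refine (MonoidHom.mem_ker).mpr (RingEquiv.ext fun y ↦ ?_)
      obtain ⟨y, rfl⟩ := IsLocalRing.residue_surjective y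
      exact (hval σ hσ y).mpr (h1 y y.2).2
  simp only [strictHenselization, IntermediateField.mem_fixedField_iff, key, and_imp]

/-- If inertial automorphisms over K already fix L, the inertia groups over K and L coincide, and
the strict henselisations have relative degree 1. -/
lemma isTamelyRamified_of_forall_isInertial {K L : Type u} [Field K] [Field L] [Algebra K L]
    {W : ValuationSubring L}
    (h : ∀ (Ω : Type u) [Field Ω] [Algebra K Ω] [Algebra L Ω] [IsScalarTower K L Ω]
      (W' : ValuationSubring Ω), W'.comap (algebraMap L Ω) = W → ∀ σ : Ω ≃ₐ[K] Ω,
      IsInertial W' σ → ∀ x, σ (algebraMap L Ω x) = algebraMap L Ω x) :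
    IsTamelyRamified K W := by
  intro Ω _ _ _ _ _ W' hW'
  have hle : (strictHenselization L W').restrictScalars K ≤ strictHenselization K W' := by
    intro z hz
    rw [IntermediateField.mem_restrictScalars, mem_strictHenselization_iff] at hz
    rw [mem_strictHenselization_iff]
    intro σ h1 h2
    exact hz (AlgEquiv.ofRingEquiv (f := σ.toRingEquiv) (h Ω W' hW' σ h1)) h1 h2
  rw [IntermediateField.relfinrank_eq_one_of_le hle]
  simp

lemma IsTamelyRamified.of_ringEquiv {K L K' L' : Type u} [Field K] [Field L] [Algebra K L]
    [Field K'] [Field L'] [Algebra K' L'] (eK : K ≃+* K') (eL : L ≃+* L')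
    (he : ∀ x, eL (algebraMap K L x) = algebraMap K' L' (eK x)) {W' : ValuationSubring L'}
    (h : IsTamelyRamified K (W'.comap eL.toRingHom)) : IsTamelyRamified K' W' := by
  intro Ω _ _ _ _ _ V hV
  let : Algebra K Ω := ((algebraMap K' Ω).comp eK.toRingHom).toAlgebra
  let : Algebra L Ω := ((algebraMap L' Ω).comp eL.toRingHom).toAlgebra
  have : IsScalarTower K L Ω := .of_algebraMap_eq fun x ↦ by
    simp only [RingHom.algebraMap_toAlgebra, RingHom.comp_apply]
    change algebraMap K' Ω (eK x) = algebraMap L' Ω (eL (algebraMap K L x))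
    rw [he, ← IsScalarTower.algebraMap_apply]
  have : IsSepClosure L Ω := by
    refine ⟨IsSepClosure.sep_closed L', ?_⟩
    have := IsSepClosure.separable (k := L') (K := Ω)
    exact Algebra.IsSeparable.of_equiv_equiv eL.symm (RingEquiv.refl Ω) (by
      ext x
      change algebraMap L' Ω (eL (eL.symm x)) = algebraMap L' Ω x
      rw [eL.apply_symm_apply])
  have h1 := h Ω V (by rw [← hV]; rfl)
  have hK (σ : Ω → Ω) : (∀ x, σ (algebraMap K Ω x) = algebraMap K Ω x) ↔
      (∀ x, σ (algebraMap K' Ω x) = algebraMap K' Ω x) :=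
    eK.surjective.forall (p := fun x ↦ σ (algebraMap K' Ω x) = algebraMap K' Ω x) |>.symm
  have hL (σ : Ω → Ω) : (∀ x, σ (algebraMap L Ω x) = algebraMap L Ω x) ↔
      (∀ x, σ (algebraMap L' Ω x) = algebraMap L' Ω x) :=
    eL.surjective.forall (p := fun x ↦ σ (algebraMap L' Ω x) = algebraMap L' Ω x) |>.symm
  have e1 : (strictHenselization K V).toSubfield = (strictHenselization K' V).toSubfield := by
    ext z
    simp only [IntermediateField.mem_toSubfield, mem_strictHenselization_iff]
    exact ⟨fun H σ ↦ H (AlgEquiv.ofRingEquiv (f := σ.toRingEquiv) ((hK _).mpr σ.commutes)),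
      fun H σ ↦ H (AlgEquiv.ofRingEquiv (f := σ.toRingEquiv) ((hK _).mp σ.commutes))⟩
  have e2 : (strictHenselization L V).toSubfield = (strictHenselization L' V).toSubfield := by
    ext z
    simp only [IntermediateField.mem_toSubfield, mem_strictHenselization_iff]
    exact ⟨fun H σ ↦ H (AlgEquiv.ofRingEquiv (f := σ.toRingEquiv) ((hL _).mpr σ.commutes)),
      fun H σ ↦ H (AlgEquiv.ofRingEquiv (f := σ.toRingEquiv) ((hL _).mp σ.commutes))⟩
  have e3 : IntermediateField.relfinrank (strictHenselization K V)
      ((strictHenselization L V).restrictScalars K) =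
      IntermediateField.relfinrank (strictHenselization K' V)
      ((strictHenselization L' V).restrictScalars K') := by
    change Subfield.relfinrank (strictHenselization K V).toSubfield
      (strictHenselization L V).toSubfield = Subfield.relfinrank
      (strictHenselization K' V).toSubfield (strictHenselization L' V).toSubfield
    rw [e1, e2]
  rw [← e3]
  generalize IntermediateField.relfinrank (strictHenselization K V)
      ((strictHenselization L V).restrictScalars K) = n at h1 ⊢
  let r : W'.comap eL.toRingHom →+* W' := 
    (eL.toRingHom.comp (W'.comap eL.toRingHom).subtype).codRestrict W'.toSubring fun x ↦ x.2
  have hu : IsUnit (n : W'.comap eL.toRingHom) := by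
    by_contra hn
    refine h1 ?_
    rw [← map_natCast (IsLocalRing.residue (W'.comap eL.toRingHom)),
      IsLocalRing.residue_eq_zero_iff]
    exact hn
  have := (hu.map r).map (IsLocalRing.residue W')
  rw [map_natCast, map_natCast] at this
  exact this.ne_zero

end TameAlgebra

/-! ### Evaluation at points and valuations on schemes -/

section Schemes

/-- Evaluation at a point `x` of an `A`-scheme. -/
noncomputable def evalAt {X : Scheme.{u}} {A : Type u} [CommRing A] (φ : X ⟶ Spec (CommRingCat.of A)) (x : X) :
    A →+* X.residueField x :=
  (Spec.preimage (X.fromSpecResidueField x ≫ φ)).hom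

lemma specMap_evalAt {X : Scheme.{u}} {A : Type u} [CommRing A] (φ : X ⟶ Spec (CommRingCat.of A))
    (x : X) : Spec.map (CommRingCat.ofHom (evalAt φ x)) = X.fromSpecResidueField x ≫ φ :=
  Spec.map_preimage _

lemma evalAt_eq_iff {X : Scheme.{u}} {A : Type u} [CommRing A] {φ : X ⟶ Spec (CommRingCat.of A)}
    {x : X} {f : A →+* X.residueField x} :
    evalAt φ x = f ↔ X.fromSpecResidueField x ≫ φ = Spec.map (CommRingCat.ofHom f) := by
  rw [← specMap_evalAt, Spec.map_injective.eq_iff]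
  exact ⟨fun h ↦ h ▸ rfl, fun h ↦ congrArg CommRingCat.Hom.hom h⟩

lemma evalAt_comp {X Y : Scheme.{u}} {A : Type u} [CommRing A] (f : Y ⟶ X)
    (φ : X ⟶ Spec (CommRingCat.of A)) (y : Y) :
    evalAt (f ≫ φ) y = (f.residueFieldMap y).hom.comp (evalAt φ (f y)) := by
  rw [evalAt_eq_iff, CommRingCat.ofHom_comp, Spec.map_comp, specMap_evalAt,
    CommRingCat.ofHom_hom, Scheme.Hom.SpecMap_residueFieldMap_fromSpecResidueField_assoc]

lemma evalAt_specMap {X : Scheme.{u}} {A B : Type u} [CommRing A] [CommRing B] [Algebra A B]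
    (φ : X ⟶ Spec (CommRingCat.of B)) (x : X) :
    evalAt (φ ≫ specMap A B) x = (evalAt φ x).comp (algebraMap A B) := by
  rw [evalAt_eq_iff, CommRingCat.ofHom_comp, Spec.map_comp, specMap_evalAt, Category.assoc]

lemma PointedValuation.map_map {X Y Z : Scheme.{u}} (f : Z ⟶ Y) (g : Y ⟶ X)
    (b : PointedValuation Z) : (b.map f).map g = b.map (f ≫ g) := by
  obtain ⟨z, W⟩ := b
  simp only [PointedValuation.map, Scheme.residueFieldMap_comp]
  rfl

lemma PointedValuation.map_id {X : Scheme.{u}} (b : PointedValuation X) : b.map (𝟙 X) = b := by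
  obtain ⟨z, W⟩ := b
  simp only [PointedValuation.map, Scheme.residueFieldMap_id]
  rfl

/-- The hypothesis `hb` says that the valuation has a centre on Spec B. For an inertial σ, the maps
B → W' before and after applying σ agree on A and modulo the maximal ideal, so they agree by
rigidity of unramified algebras: σ fixes the residue field, and there is no ramification. -/
lemma PointedValuation.isTame_of_isPullback {C C' : Scheme.{u}} {A B : Type u} [CommRing A]
    [CommRing B] [Algebra A B] [Algebra.FormallyUnramified A B] [Algebra.EssFiniteType A B]
    {g : C' ⟶ C} {g' : C' ⟶ Spec (CommRingCat.of B)} {φ : C ⟶ Spec (CommRingCat.of A)}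
    (h : IsPullback g' g (specMap A B) φ) (b : PointedValuation C')
    (hb : ∀ x, evalAt g' b.point x ∈ b.ring) : b.IsTame g := by
  let := (g.residueFieldMap b.point).hom.toAlgebra
  refine isTamelyRamified_of_forall_isInertial fun Ω _ _ _ _ W' hW' σ hσ ↦ ?_
  let i : C'.residueField b.point →+* Ω := algebraMap _ Ω
  let β := evalAt g' b.point
  have hcomm : β.comp (algebraMap A B) =
      (g.residueFieldMap b.point).hom.comp (evalAt φ (g b.point)) := by
    rw [← evalAt_comp, ← evalAt_specMap, h.w]
  have hiσ : (σ : Ω →+* Ω).comp (i.comp (g.residueFieldMap b.point).hom) =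
      i.comp (g.residueFieldMap b.point).hom := by
    ext x
    have := σ.commutes x
    rwa [IsScalarTower.algebraMap_apply _ (C'.residueField b.point) Ω] at this
  have hβ : ((σ : Ω →+* Ω).comp i).comp β = i.comp β := by
    have hmem (x) : i (β x) ∈ W' := by
      have := hb x
      rwa [← hW'] at this
    let f : B →+* W' := (i.comp β).codRestrict W'.toSubring hmem
    let f' : B →+* W' := ((σ : Ω →+* Ω).comp (i.comp β)).codRestrict W'.toSubring
      fun x ↦ (hσ _ (hmem x)).1
    let : Algebra A W' := (f.comp (algebraMap A B)).toAlgebra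
    have hf' (a : A) : f' (algebraMap A B a) = f (algebraMap A B a) := by
      apply Subtype.ext
      change σ (i (β (algebraMap A B a))) = i (β (algebraMap A B a))
      rw [← RingHom.comp_apply β, hcomm]
      exact DFunLike.congr_fun hiσ (evalAt φ (g b.point) a)
    let F : B →ₐ[A] W' := { f with commutes' := fun _ ↦ rfl }
    let F' : B →ₐ[A] W' := { f' with commutes' := hf' }
    have hF : F' = F := by
      refine algHom_eq_of_sub_mem_jacobson F' F fun x ↦ ?_
      rw [IsLocalRing.jacobson_eq_maximalIdeal _ bot_ne_top,
        ValuationSubring.valuation_lt_one_iff]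
      exact (hσ _ (hmem x)).2
    ext x
    exact congrArg Subtype.val (DFunLike.congr_fun hF x)
  -- A point of C' is determined by its images in Spec B and C, and σ changes neither; a residue
  -- field embeds as a monomorphism.
  have key : (σ : Ω →+* Ω).comp i = i := by
    have h1 : Spec.map (CommRingCat.ofHom ((σ : Ω →+* Ω).comp i)) ≫
        C'.fromSpecResidueField b.point =
        Spec.map (CommRingCat.ofHom i) ≫ C'.fromSpecResidueField b.point := by
      refine h.hom_ext ?_ ?_
      · simp only [Category.assoc]
        rw [← specMap_evalAt, ← Spec.map_comp, ← Spec.map_comp, ← CommRingCat.ofHom_comp,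
          ← CommRingCat.ofHom_comp, hβ]
      · simp only [Category.assoc]
        rw [← Scheme.Hom.SpecMap_residueFieldMap_fromSpecResidueField, ← Spec.map_comp_assoc, 
          ← Spec.map_comp_assoc, ← CommRingCat.ofHom_hom (g.residueFieldMap b.point),
          ← CommRingCat.ofHom_comp, ← CommRingCat.ofHom_comp]
        congr 3
    rw [cancel_mono] at h1
    exact congrArg CommRingCat.Hom.hom (Spec.map_injective h1)
  exact fun x ↦ congr($key x)

/-- Surjective maps of residue fields are isomorphisms, so both sides concern the same extension of
valued fields. Used for closed immersions and isomorphisms. -/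
lemma PointedValuation.isTame_map_iff {X X' Y Y' : Scheme.{u}} {f : Y ⟶ X} {f' : Y' ⟶ X'}
    {h : X' ⟶ X} {h' : Y' ⟶ Y} (comm : h' ≫ f = f' ≫ h) (b : PointedValuation Y')
    (hb : Function.Surjective (h'.residueFieldMap b.point).hom)
    (hb' : Function.Surjective (h.residueFieldMap (f' b.point)).hom) :
    (b.map h').IsTame f ↔ b.IsTame f' := by
  let := (f'.residueFieldMap b.point).hom.toAlgebra
  let : Algebra (X.residueField (f (h' b.point))) (Y.residueField (h' b.point)) :=
    (f.residueFieldMap (h' b.point)).hom.toAlgebra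
  let eL : Y.residueField (h' b.point) ≃+* Y'.residueField b.point :=
    .ofBijective _ ⟨RingHom.injective _, hb⟩
  have hx : f (h' b.point) = h (f' b.point) := by
    rw [← Scheme.Hom.comp_apply, ← Scheme.Hom.comp_apply, comm]
  let eK : X.residueField (f (h' b.point)) ≃+* X'.residueField (f' b.point) :=
    (X.residueFieldCongr hx).commRingCatIsoToRingEquiv.trans
      (.ofBijective _ ⟨RingHom.injective _, hb'⟩)
  have he (x) : eL (algebraMap (X.residueField (f (h' b.point))) _ x) =
      algebraMap (X'.residueField (f' b.point)) _ (eK x) := by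
    have h1 := Scheme.Hom.residueFieldMap_congr comm b.point
    rw [Scheme.residueFieldMap_comp, Scheme.residueFieldMap_comp] at h1
    exact congr($(h1).hom x)
  refine ⟨fun H ↦ IsTamelyRamified.of_ringEquiv eK eL he H, fun H ↦ ?_⟩
  refine IsTamelyRamified.of_ringEquiv (K := X'.residueField (f' b.point)) eK.symm eL.symm
    (fun x ↦ ?_) ?_
  · rw [RingEquiv.symm_apply_eq, he, eK.apply_symm_apply]
  · let V : ValuationSubring (Y.residueField (h' b.point)) := (b.map h').ring
    have hV : V.comap eL.symm.toRingHom = b.ring := by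
      ext x
      change eL (eL.symm x) ∈ b.ring ↔ _
      rw [eL.apply_symm_apply]
    change IsTamelyRamified _ (V.comap eL.symm.toRingHom)
    rw [hV]
    exact H

lemma PointedValuation.exists_map_eq {X Y : Scheme.{u}} (f : Y ⟶ X) (a : PointedValuation X)
    {y : Y} (hy : f y = a.point) (hs : Function.Surjective (f.residueFieldMap y).hom) :
    ∃ b : PointedValuation Y, b.point = y ∧ b.map f = a := by
  obtain ⟨x, V⟩ := a
  obtain rfl : f y = x := hy
  let e : X.residueField (f y) ≃+* Y.residueField y := .ofBijective _ ⟨RingHom.injective _, hs⟩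
  refine ⟨⟨y, V.comap e.symm.toRingHom⟩, rfl, ?_⟩
  simp only [map]
  congr 1
  ext z
  change e.symm (e z) ∈ V ↔ _
  rw [e.symm_apply_apply]

lemma PointedValuation.map_injective {X Y : Scheme.{u}} (f : Y ⟶ X) (hf : Function.Injective f)
    (hs : ∀ y, Function.Surjective (f.residueFieldMap y).hom) :
    Function.Injective (PointedValuation.map f) := by
  rintro ⟨x, V⟩ ⟨y, W⟩ h
  obtain rfl : x = y := hf congr(($h).point)
  simp only [map, mk.injEq, heq_eq_eq, true_and] at h
  congr 1
  ext z
  obtain ⟨z, rfl⟩ := hs x z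
  exact SetLike.ext_iff.mp h z

lemma PointedValuation.isSValuation_iff {X : Scheme.{u}} {R : Type u} [CommRing R]
    {p : X ⟶ Spec (CommRingCat.of R)} {a : PointedValuation X} :
    a.IsSValuation p ↔ ∀ r, evalAt p a.point r ∈ a.ring := by
  constructor
  · rintro ⟨ψ, hψ⟩ r
    have : evalAt p a.point = a.ring.subtype.comp (Spec.preimage ψ).hom := by
      rw [evalAt_eq_iff, ← hψ, CommRingCat.ofHom_comp, Spec.map_comp, CommRingCat.ofHom_hom,
        Spec.map_preimage]
    rw [this]
    exact ((Spec.preimage ψ).hom r).2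
  · intro h
    refine ⟨Spec.map (CommRingCat.ofHom ((evalAt p a.point).codRestrict a.ring.toSubring h)), ?_⟩
    rw [← Spec.map_comp, ← specMap_evalAt]
    rfl

lemma PointedValuation.isSValuation_map_iff {X Y : Scheme.{u}} {f : Y ⟶ X}
    {b : PointedValuation Y} {R : Type u} [CommRing R]
    {p : X ⟶ Spec (CommRingCat.of R)} :
    (b.map f).IsSValuation p ↔ b.IsSValuation (f ≫ p) := by
  simp only [isSValuation_iff, evalAt_comp]
  rfl

/-- Evaluation at η factors through the stalk at x. This is what makes the valuation attached to a
boundary point of a curve an S-valuation. -/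
lemma evalAt_mem_localRingAt {X : Scheme.{u}} {R : Type u} [CommRing R]
    (q : X ⟶ Spec (CommRingCat.of R)) {η x : X} (h : η ⤳ x) (r : R) :
    evalAt q η r ∈ localRingAt h := by
  have : evalAt q η = (X.presheaf.stalkSpecializes h ≫ X.residue η).hom.comp
      (Spec.preimage (X.fromSpecStalk x ≫ q)).hom := by
    rw [evalAt_eq_iff, CommRingCat.ofHom_comp, Spec.map_comp, CommRingCat.ofHom_hom,
      CommRingCat.ofHom_hom, Spec.map_preimage, Spec.map_comp, Category.assoc,
      Scheme.SpecMap_stalkSpecializes_fromSpecStalk_assoc]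
    rfl
  rw [this]
  exact ⟨_, rfl⟩

lemma evalAt_eq_zero_iff {X : Scheme.{u}} {A : Type u} [CommRing A]
    (φ : X ⟶ Spec (CommRingCat.of A)) (x : X) (a : A) :
    evalAt φ x a = 0 ↔ a ∈ (φ x).asIdeal := by
  obtain ⟨z⟩ : Nonempty (Spec (X.residueField x)) := inferInstance
  have h1 : Spec.map (CommRingCat.ofHom (evalAt φ x)) z = φ x := by
    rw [specMap_evalAt]
    exact congrArg φ (Scheme.fromSpecResidueField_apply x z)
  rw [← h1]
  change _ ↔ evalAt φ x a ∈ PrimeSpectrum.asIdeal z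
  have hz : PrimeSpectrum.asIdeal z = ⊥ :=
    @Ideal.eq_bot_of_prime (X.residueField x) _ _ (PrimeSpectrum.isPrime z)
  rw [hz]
  rfl

/-- On an integral scheme a function vanishing at the generic point is zero, so I dies in the global
sections. -/
lemma exists_fac_of_evalAt_eq_zero {X : Scheme.{u}} [IsIntegral X] {A : Type u} [CommRing A]
    (φ : X ⟶ Spec (CommRingCat.of A)) {I : Ideal A}
    (h : ∀ a ∈ I, evalAt φ (genericPoint X) a = 0) :
    ∃ φ₀ : X ⟶ Spec (CommRingCat.of (A ⧸ I)), φ₀ ≫ specMap A (A ⧸ I) = φ := by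
  let α : CommRingCat.of A ⟶ Γ(X, ⊤) := (Scheme.ΓSpecIso _).inv ≫ φ.appTop
  have hα : X.toSpecΓ ≫ Spec.map α = φ := by
    rw [Spec.map_comp, ← Scheme.toSpecΓ_naturality_assoc, ← SpecMap_ΓSpecIso_hom,
      ← Spec.map_comp, Iso.inv_hom_id, Spec.map_id, Category.comp_id]
  have hα0 : ∀ a ∈ I, α.hom a = 0 := by
    intro a ha
    have h1 : evalAt φ (genericPoint X) = (X.Γevaluation (genericPoint X)).hom.comp α.hom := by
      rw [evalAt_eq_iff, CommRingCat.ofHom_comp, Spec.map_comp, CommRingCat.ofHom_hom,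
        CommRingCat.ofHom_hom]
      nth_rw 1 [← hα]
      rw [Scheme.fromSpecResidueField, Category.assoc, Scheme.fromSpecStalk_toSpecΓ_assoc,
        ← Spec.map_comp_assoc]
      rfl
    have h2 := h a ha
    rw [h1, RingHom.comp_apply] at h2
    rw [← basicOpen_eq_bot_iff, ← TopologicalSpace.Opens.coe_eq_empty,
      ← Set.not_nonempty_iff_eq_empty]
    exact fun hne ↦ (X.evaluation_eq_zero_iff_notMem_basicOpen (U := ⊤) _ trivial _).mp h2
      (((genericPoint_spec X).mem_open_set_iff (X.basicOpen _).isOpen).mpr (by simpa using hne))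
  refine ⟨X.toSpecΓ ≫ Spec.map (CommRingCat.ofHom (Ideal.Quotient.lift I α.hom hα0)), ?_⟩
  rw [Category.assoc, ← Spec.map_comp, ← CommRingCat.ofHom_comp]
  exact hα

end Schemes

end TameRigidity

namespace TameRigidity

/-! ### Curve-tameness is detected on A/I -/

section CurveTame

lemma mem_valuationSubring_of_isIntegralElem {A K : Type*} [CommRing A] [Field K]
    {V : ValuationSubring K} {f : A →+* K} (hf : ∀ a, f a ∈ V) {x : K} (hx : f.IsIntegralElem x) :
    x ∈ V := by
  have h : IsIntegral V x := by
    obtain ⟨p, hp, h⟩ := hx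
    refine ⟨p.map (f.codRestrict V.toSubring hf), hp.map _, ?_⟩
    rw [Polynomial.eval₂_map]
    exact h
  obtain ⟨y, rfl⟩ := IsIntegrallyClosed.isIntegral_iff.mp h
  exact y.2

lemma specMap_comp_specMap (A B C : Type u) [CommRing A] [CommRing B] [CommRing C] [Algebra A B]
    [Algebra A C] [Algebra B C] [IsScalarTower A B C] : specMap B C ≫ specMap A B = specMap A C := by
  rw [← Spec.map_comp, ← CommRingCat.ofHom_comp, ← IsScalarTower.algebraMap_eq]

lemma isPullback_specMap (A A' B B' : Type u) [CommRing A] [CommRing A'] [CommRing B] [CommRing B']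
    [Algebra A A'] [Algebra A B] [Algebra A B'] [Algebra A' B'] [Algebra B B']
    [IsScalarTower A A' B'] [IsScalarTower A B B'] [h : Algebra.IsPushout A A' B B'] :
    IsPullback (specMap A' B') (specMap B B') (specMap A A') (specMap A B) :=
  isPullback_SpecMap_of_isPushout _ _ _ _ (CommRingCat.isPushout_of_isPushout A A' B B')

lemma residueFieldMap_surjective_of_isIso {X Y : Scheme.{u}} (f : X ⟶ Y) [IsIso f] (x : X) :
    Function.Surjective (f.residueFieldMap x).hom :=
  (ConcreteCategory.bijective_of_isIso (f.residueFieldMap x)).2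

lemma IsTamelyRamifiedAlongBoundary.of_isIso {C C' C'' Cb : Scheme.{u}} [IrreducibleSpace C]
    {j : C ⟶ Cb} [IsDominant j] {g : C' ⟶ C} (e : C'' ⟶ C') [IsIso e]
    (H : IsTamelyRamifiedAlongBoundary j (e ≫ g)) : IsTamelyRamifiedAlongBoundary j g := by
  intro x hx b hb hring
  obtain ⟨b, rfl⟩ : ∃ b' : PointedValuation C'', b'.map e = b :=
    ⟨b.map (inv e), by rw [PointedValuation.map_map, IsIso.inv_hom_id, PointedValuation.map_id]⟩
  have key (c c' : PointedValuation C) (h : c = c') (hc : c.point = genericPoint C)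
      (hc' : c'.point = genericPoint C)
      (H : (c.map j).ring.toSubring = localRingAt (specializes_of_isDominant j hc x)) :
      (c'.map j).ring.toSubring = localRingAt (specializes_of_isDominant j hc' x) := by
    subst h; exact H
  have h1 := H x hx b hb (key _ _ (PointedValuation.map_map e g b) hb hb hring)
  refine (PointedValuation.isTame_map_iff (h := 𝟙 C) (by simp) b
    (residueFieldMap_surjective_of_isIso e _) (residueFieldMap_surjective_of_isIso _ _)).mpr h1

lemma isTamelyRamifiedAlongBoundary_pullback_iff {A A' B B' : Type u} [CommRing A] [CommRing A']
    [CommRing B] [CommRing B'] [Algebra A A'] [Algebra A B] [Algebra A B'] [Algebra A' B']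
    [Algebra B B'] [IsScalarTower A A' B'] [IsScalarTower A B B'] [Algebra.IsPushout A A' B B']
    {C Cb : Scheme.{u}} [IrreducibleSpace C] {j : C ⟶ Cb} [IsDominant j]
    (φ : C ⟶ Spec (CommRingCat.of A')) :
    IsTamelyRamifiedAlongBoundary j (Limits.pullback.fst (φ ≫ specMap A A') (specMap A B)) ↔
      IsTamelyRamifiedAlongBoundary j (Limits.pullback.fst φ (specMap A' B')) := by
  have h' := (IsPullback.of_hasPullback φ (specMap A' B')).paste_vert
    (isPullback_specMap A A' B B')
  constructor
  · intro H
    refine .of_isIso h'.isoPullback.inv ?_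
    rwa [h'.isoPullback_inv_fst]
  · intro H
    refine .of_isIso h'.isoPullback.hom ?_
    rwa [h'.isoPullback_hom_fst]

variable {R : Type u} [CommRing R] [IsDomain R] [IsDiscreteValuationRing R]
    [HenselianLocalRing R] {π : R} {A : Type u} [CommRing A] [Algebra R A]
    [Algebra.EssFiniteType R A] {I : Ideal A}

/-- At such a point the image of A is integral over R, and valuation rings are integrally closed. -/
lemma evalAt_mem_of_isSValuation (hπ : Irreducible π) (hI : I = Ideal.span {algebraMap R A π})
    [HenselianRing A I] {X : Scheme.{u}} {φ : X ⟶ Spec (CommRingCat.of A)}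
    {a : PointedValuation X} (ha : a.IsSValuation (φ ≫ specMap R A))
    (hne : evalAt φ a.point (algebraMap R A π) ≠ 0) (x : A) : evalAt φ a.point x ∈ a.ring := by
  rw [PointedValuation.isSValuation_iff, evalAt_specMap] at ha
  exact mem_valuationSubring_of_isIntegralElem ha
    (isIntegralElem_of_map_ne_zero hπ hI (evalAt φ a.point) hne x)

/-- Both A and the finite algebra B land in the valuation ring, so the cover is unramified there.
This disposes of all points where π does not vanish. -/
lemma isTame_of_isSValuation (hπ : Irreducible π) (hI : I = Ideal.span {algebraMap R A π})
    [HenselianRing A I] {B : Type u} [CommRing B] [Algebra A B] [Module.Finite A B]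
    [Algebra.Etale A B] {C C' : Scheme.{u}} {g : C' ⟶ C} {g' : C' ⟶ Spec (CommRingCat.of B)}
    {φ : C ⟶ Spec (CommRingCat.of A)} (h : IsPullback g' g (specMap A B) φ)
    {b : PointedValuation C'} (hb : (b.map g).IsSValuation (φ ≫ specMap R A))
    (hne : evalAt φ (g b.point) (algebraMap R A π) ≠ 0) : b.IsTame g := by
  refine b.isTame_of_isPullback h fun x ↦ ?_
  have h1 : ∀ a, (evalAt g' b.point).comp (algebraMap A B) a ∈ b.ring := by
    intro a
    rw [← evalAt_specMap, h.w, evalAt_comp]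
    exact evalAt_mem_of_isSValuation hπ hI hb hne a
  refine mem_valuationSubring_of_isIntegralElem h1 ?_
  obtain ⟨p, hp, hpx⟩ := Algebra.IsIntegral.isIntegral (R := A) x
  refine ⟨p, hp, ?_⟩
  rw [← Polynomial.hom_eval₂, hpx, map_zero]

/-- A finite étale cover of `A` is curve-tame iff its restriction to `A ⧸ I` is. -/
theorem isCurveTame_iff (hπ : Irreducible π) (hI : I = Ideal.span {algebraMap R A π})
    [HenselianRing A I] {B B₀ : Type u} [CommRing B] [CommRing B₀] [Algebra A B] [Algebra A B₀]
    [Algebra (A ⧸ I) B₀] [Algebra B B₀] [IsScalarTower A (A ⧸ I) B₀] [IsScalarTower A B B₀]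
    [Algebra.IsPushout A (A ⧸ I) B B₀] [Module.Finite A B] [Algebra.Etale A B] :
    IsCurveTame (specMap R A) (specMap A B) ↔
      IsCurveTame (specMap R (A ⧸ I)) (specMap (A ⧸ I) B₀) := by
  have hcomp {C : Scheme.{u}} (φ : C ⟶ Spec (CommRingCat.of (A ⧸ I))) :
      (φ ≫ specMap A (A ⧸ I)) ≫ specMap R A = φ ≫ specMap R (A ⧸ I) := by
    rw [Category.assoc, specMap_comp_specMap]
  constructor
  · intro H C φ hC Cb qb j hj
    have := hC.integral
    have := hj.dominant
    rw [← isTamelyRamifiedAlongBoundary_pullback_iff (A := A) (B := B)]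
    exact H C _ (by rwa [hcomp]) Cb qb j (by rwa [hcomp])
  · intro H C φ hC Cb qb j hj
    have := hC.integral
    have := hj.dominant
    -- Either π vanishes on C, and the curve maps to Spec A/I, or it is nonzero at the generic
    -- point, where tameness along the boundary is automatic.
    by_cases h0 : evalAt φ (genericPoint C) (algebraMap R A π) = 0
    · obtain ⟨φ, rfl⟩ := exists_fac_of_evalAt_eq_zero (I := I) φ (by
        intro a ha
        rw [hI] at ha
        obtain ⟨c, rfl⟩ := Ideal.mem_span_singleton.mp ha
        rw [map_mul, h0, zero_mul])
      rw [hcomp] at hC hj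
      have := H C φ hC Cb qb j hj
      rwa [isTamelyRamifiedAlongBoundary_pullback_iff (B' := B₀)]
    · intro x hx b hb hring
      refine isTame_of_isSValuation hπ hI (IsPullback.of_hasPullback φ (specMap A B)).flip ?_ ?_
      · rw [← hj.w, ← PointedValuation.isSValuation_map_iff, PointedValuation.isSValuation_iff]
        intro r
        change evalAt qb _ r ∈ ((b.map _).map j).ring.toSubring
        rw [hring]
        exact evalAt_mem_localRingAt qb _ r
      · rwa [hb]

end CurveTame

end TameRigidity

namespace TameRigidity

/-! ### Tame coverings are detected on A/I -/

section TameCovering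

/-- Choose W dominating the image of V; valuation rings are maximal for domination, so W restricts
to exactly V. -/
lemma exists_valuationSubring_comap_eq {K L : Type*} [Field K] [Field L] (f : K →+* L)
    (V : ValuationSubring K) : ∃ W : ValuationSubring L, W.comap f = V := by
  obtain ⟨W, hW⟩ := (V.toLocalSubring.map f).exists_le_valuationSubring
  refine ⟨W, ?_⟩
  apply ValuationSubring.toLocalSubring_injective
  refine ((V.isMax_toLocalSubring).eq_of_le ?_).symm
  rw [LocalSubring.le_def] at hW ⊢
  obtain ⟨h1, h2⟩ := hW
  have hle : V.toLocalSubring.toSubring ≤ (W.comap f).toLocalSubring.toSubring :=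
    fun x hx ↦ h1 ⟨x, hx, rfl⟩
  refine ⟨hle, ⟨fun x hx ↦ ?_⟩⟩
  have hx1 : f x.1 ∈ (V.toLocalSubring.map f).toSubring := ⟨x.1, x.2, rfl⟩
  have h3 : IsUnit (Subring.inclusion h1 ⟨f x.1, hx1⟩) := by
    let r : W.comap f →+* W.toLocalSubring.toSubring :=
      (f.comp (W.comap f).subtype).codRestrict W.toSubring fun x ↦ x.2
    exact hx.map r
  have h4 := isUnit_of_map_unit _ _ h3
  obtain ⟨⟨_, y, hy, rfl⟩, h5⟩ := h4.exists_right_inv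
  refine IsUnit.of_mul_eq_one (⟨y, hy⟩ : V.toLocalSubring.toSubring) ?_
  apply Subtype.ext
  apply f.injective
  have := congrArg Subtype.val h5
  change f x.1 * f y = 1 at this
  change f (x.1 * y) = f 1
  rw [map_mul, this, map_one]

lemma etale_specMap (A B : Type u) [CommRing A] [CommRing B] [Algebra A B] [Algebra.Etale A B] :
    Etale (specMap A B) := by
  rw [HasRingHomProperty.Spec_iff (P := @Etale)]
  exact RingHom.etale_algebraMap.mpr inferInstance

lemma residueFieldMap_surjective_of_isClosedImmersion {X Y : Scheme.{u}} (f : X ⟶ Y)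
    [IsClosedImmersion f] (x : X) : Function.Surjective (f.residueFieldMap x).hom := by
  have h : Function.Surjective (Y.residue (f x) ≫ f.residueFieldMap x).hom := by
    rw [Scheme.residue_residueFieldMap]
    exact (X.residue_surjective x).comp (f.stalkMap_surjective x)
  exact Function.Surjective.of_comp (g := (Y.residue (f x)).hom) h

instance isClosedImmersion_specMap_quotient {A : Type u} [CommRing A] (I : Ideal A) :
    IsClosedImmersion (specMap A (A ⧸ I)) :=
  IsClosedImmersion.spec_of_surjective _ Ideal.Quotient.mk_surjective

lemma exists_specMap_eq {A : Type u} [CommRing A] {I : Ideal A} {x : Spec (CommRingCat.of A)}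
    (h : ∀ a ∈ I, a ∈ PrimeSpectrum.asIdeal x) : ∃ y, specMap A (A ⧸ I) y = x := by
  have : x ∈ Set.range (PrimeSpectrum.comap (Ideal.Quotient.mk I)) := by
    rw [range_comap_of_surjective _ _ Ideal.Quotient.mk_surjective, Ideal.mk_ker]
    exact h
  exact this

lemma IsPullback.exists_point_eq {P X Y Z : Scheme.{u}} {fst : P ⟶ X} {snd : P ⟶ Y} {f : X ⟶ Z}
    {g : Y ⟶ Z} (h : IsPullback fst snd f g) {x : X} {y : Y} (hxy : f x = g y) :
    ∃ p, fst p = x ∧ snd p = y := by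
  obtain ⟨p, rfl, rfl⟩ := Scheme.Pullback.exists_preimage_pullback x y hxy
  refine ⟨h.isoPullback.inv p, ?_, ?_⟩
  · rw [← Scheme.Hom.comp_apply, h.isoPullback_inv_fst]
  · rw [← Scheme.Hom.comp_apply, h.isoPullback_inv_snd]

/-- Maximal ideals of A contain I, so they are all hit through B₀; a flat algebra hitting all
maximal ideals is faithfully flat. -/
lemma comap_surjective_of_comap_surjective_quotient {A B B₀ : Type*} [CommRing A] [CommRing B]
    [CommRing B₀] {I : Ideal A} (hI : I ≤ Ideal.jacobson ⊥) [Algebra A B] [Module.Flat A B]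
    [Algebra (A ⧸ I) B₀] [Algebra A B₀] [Algebra B B₀] [IsScalarTower A (A ⧸ I) B₀]
    [IsScalarTower A B B₀]
    (h : Function.Surjective (PrimeSpectrum.comap (algebraMap (A ⧸ I) B₀))) :
    Function.Surjective (PrimeSpectrum.comap (algebraMap A B)) := by
  have : Module.FaithfullyFlat A B := by
    refine ⟨fun m hm htop ↦ ?_⟩
    have hIm : I ≤ m := hI.trans (sInf_le ⟨bot_le, hm⟩)
    have : (⟨m, hm.isPrime⟩ : PrimeSpectrum A) ∈
        Set.range (PrimeSpectrum.comap (Ideal.Quotient.mk I)) := by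
      rw [range_comap_of_surjective _ _ Ideal.Quotient.mk_surjective, Ideal.mk_ker]
      exact hIm
    obtain ⟨m₀, hm₀⟩ := this
    obtain ⟨q, rfl⟩ := h m₀
    have hq : (q.asIdeal.comap (algebraMap B B₀)).comap (algebraMap A B) = m := by
      have := congrArg PrimeSpectrum.asIdeal hm₀
      rw [Ideal.comap_comap, ← IsScalarTower.algebraMap_eq,
        IsScalarTower.algebraMap_eq A (A ⧸ I) B₀, ← Ideal.comap_comap]
      exact this
    have h1 : m.map (algebraMap A B) ≤ q.asIdeal.comap (algebraMap B B₀) :=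
      Ideal.map_le_iff_le_comap.mpr hq.ge
    have h2 : m.map (algebraMap A B) = ⊤ := by
      rw [Ideal.smul_top_eq_map] at htop
      simpa using htop
    exact (q.isPrime.comap (algebraMap B B₀)).ne_top (top_le_iff.mp (h2 ▸ h1))
  exact PrimeSpectrum.comap_surjective_of_faithfullyFlat

variable {R : Type u} [CommRing R] [IsDomain R] [IsDiscreteValuationRing R]
    [HenselianLocalRing R] {π : R} {A : Type u} [CommRing A] [Algebra R A]
    [Algebra.EssFiniteType R A] {I : Ideal A}

/-- A finite étale cover of `A` is a covering in the tame site iff its restriction to `A ⧸ I`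
is. -/
theorem isTameCovering_iff (hπ : Irreducible π) (hI : I = Ideal.span {algebraMap R A π})
    [HenselianRing A I] {B B₀ : Type u} [CommRing B] [CommRing B₀] [Algebra A B] [Algebra A B₀]
    [Algebra (A ⧸ I) B₀] [Algebra B B₀] [IsScalarTower A (A ⧸ I) B₀] [IsScalarTower A B B₀]
    [Algebra.IsPushout A (A ⧸ I) B B₀] [Module.Finite A B] [Algebra.Etale A B] :
    IsTameCovering (specMap R A) (specMap A B) ↔
      IsTameCovering (specMap R (A ⧸ I)) (specMap (A ⧸ I) B₀) := by
  let ι := specMap A (A ⧸ I)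
  let f := specMap A B
  let f₀ := specMap (A ⧸ I) B₀
  let ι' := specMap B B₀
  have h : IsPullback f₀ ι' ι f := isPullback_specMap A (A ⧸ I) B B₀
  have : Etale f := etale_specMap A B
  have : IsClosedImmersion ι := isClosedImmersion_specMap_quotient I
  have : Etale f₀ := MorphismProperty.of_isPullback h.flip ‹Etale f›
  have : IsClosedImmersion ι' := MorphismProperty.of_isPullback h ‹IsClosedImmersion ι›
  have hιR : ι ≫ specMap R A = specMap R (A ⧸ I) := specMap_comp_specMap R A (A ⧸ I)
  have hιs := residueFieldMap_surjective_of_isClosedImmersion ι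
  have hιs' := residueFieldMap_surjective_of_isClosedImmersion ι'
  have htame (b : PointedValuation (Spec (CommRingCat.of B₀))) :
      (b.map ι').IsTame f ↔ b.IsTame f₀ :=
    PointedValuation.isTame_map_iff h.w.symm b (hιs' _) (hιs _)
  have hmap (b : PointedValuation (Spec (CommRingCat.of B₀))) :
      (b.map f₀).map ι = (b.map ι').map f := by
    rw [PointedValuation.map_map, PointedValuation.map_map, h.w]
  constructor
  · rintro ⟨-, hsurj, H⟩
    refine ⟨‹_›, MorphismProperty.of_isPullback h.flip hsurj, fun a ha ↦ ?_⟩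
    obtain ⟨b, hb1, hb2, hb3⟩ := H (a.map ι) (by
      rwa [PointedValuation.isSValuation_map_iff, hιR])
    obtain ⟨y, hy1, hy2⟩ := IsPullback.exists_point_eq h (x := a.point) (y := b.point)
      (congrArg PointedValuation.point hb2).symm
    obtain ⟨b, -, rfl⟩ := PointedValuation.exists_map_eq ι' b hy2 (hιs' y)
    have hba : b.map f₀ = a := by
      apply PointedValuation.map_injective ι ι.isClosedEmbedding.injective hιs
      rw [hmap, hb2]
    exact ⟨b, by rwa [← PointedValuation.isSValuation_map_iff, hba], hba, (htame b).mp hb3⟩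
  · rintro ⟨-, hsurj, H⟩
    have hsurj' : Surjective f := by
      refine ⟨?_⟩
      exact comap_surjective_of_comap_surjective_quotient (B₀ := B₀) HenselianRing.jac hsurj.surj
    refine ⟨‹_›, hsurj', fun a ha ↦ ?_⟩
    by_cases h0 : algebraMap R A π ∈ PrimeSpectrum.asIdeal a.point
    · obtain ⟨x, hx⟩ := exists_specMap_eq (I := I) (x := a.point) (by
        rw [hI]
        exact (Ideal.span_singleton_le_iff_mem _).mpr h0)
      obtain ⟨a, -, rfl⟩ := PointedValuation.exists_map_eq ι a hx (hιs x)
      rw [PointedValuation.isSValuation_map_iff, hιR] at ha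
      obtain ⟨b, hb1, rfl, hb3⟩ := H a ha
      refine ⟨b.map ι', ?_, (hmap b).symm, (htame b).mpr hb3⟩
      rwa [← PointedValuation.isSValuation_map_iff, ← hmap, PointedValuation.isSValuation_map_iff, 
        hιR]
    -- Where π does not vanish, any extension of the valuation to any point above is tame.
    · obtain ⟨y, hy⟩ := f.surjective a.point
      obtain ⟨x, V⟩ := a
      obtain rfl : f y = x := hy
      obtain ⟨W, hW⟩ := exists_valuationSubring_comap_eq (f.residueFieldMap y).hom V
      have hb : PointedValuation.map f ⟨y, W⟩ = ⟨f y, V⟩ := by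
        rw [← hW]; rfl
      refine ⟨⟨y, W⟩, by rwa [← PointedValuation.isSValuation_map_iff, hb], hb, ?_⟩
      refine isTame_of_isSValuation hπ hI (g' := 𝟙 _) (φ := 𝟙 _) 
        (IsPullback.of_horiz_isIso ⟨by simp⟩) ?_ ?_
      · rw [Category.id_comp]
        rwa [← hb] at ha
      · exact fun h ↦ h0 ((evalAt_eq_zero_iff (𝟙 (Spec (CommRingCat.of A))) (f y) _).mp h)

end TameCovering

end TameRigidity

namespace TameRigidity

open TensorProduct

/-! ### Reduction modulo I, with B₀ any model of B/IB -/

section Reduction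

variable {A : Type*} [CommRing A] {I : Ideal A} {B B₀ C C₀ : Type*} [CommRing B] [CommRing B₀]
  [Algebra A B] [Algebra A B₀] [Algebra (A ⧸ I) B₀] [Algebra B B₀] [IsScalarTower A (A ⧸ I) B₀]
  [IsScalarTower A B B₀] 

variable (I B B₀) in
lemma algebraMap_surjective_of_isPushout [Algebra.IsPushout A (A ⧸ I) B B₀] :
    Function.Surjective (algebraMap B B₀) := by
  intro x
  obtain ⟨x, rfl⟩ := (Algebra.IsPushout.equiv A (A ⧸ I) B B₀).surjective x
  induction x with
  | zero => exact ⟨0, by simp⟩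
  | tmul a b =>
    obtain ⟨a, rfl⟩ := Ideal.Quotient.mk_surjective a
    refine ⟨algebraMap A B a * b, ?_⟩
    rw [Algebra.IsPushout.equiv_tmul, map_mul, ← IsScalarTower.algebraMap_apply,
      IsScalarTower.algebraMap_apply A (A ⧸ I) B₀]
    rfl
  | add x y hx hy =>
    obtain ⟨x', hx'⟩ := hx
    obtain ⟨y', hy'⟩ := hy
    exact ⟨x' + y', by rw [map_add, map_add, hx', hy']⟩

variable (I B B₀) in
lemma ker_algebraMap_of_isPushout [Algebra.IsPushout A (A ⧸ I) B B₀] :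
    RingHom.ker (algebraMap B B₀) = I.map (algebraMap A B) := by
  apply le_antisymm
  · intro b hb
    have h1 : (1 : A ⧸ I) ⊗ₜ[A] b = 0 := by
      apply (Algebra.IsPushout.equiv A (A ⧸ I) B B₀).injective
      rw [Algebra.IsPushout.equiv_tmul, map_one, one_mul, map_zero]
      exact hb
    rw [← Algebra.TensorProduct.quotIdealMapEquivQuotTensor_mk] at h1
    rw [← Ideal.Quotient.eq_zero_iff_mem]
    exact (map_eq_zero_iff _ (AlgEquiv.injective _)).mp h1
  · rw [Ideal.map_le_iff_le_comap]
    intro a ha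
    rw [Ideal.mem_comap, RingHom.mem_ker, ← IsScalarTower.algebraMap_apply,
      IsScalarTower.algebraMap_apply A (A ⧸ I) B₀, 
      show algebraMap A (A ⧸ I) a = 0 from Ideal.Quotient.eq_zero_iff_mem.mpr ha, map_zero]

lemma isPushout_of_surjective_of_ker_eq (hs : Function.Surjective (algebraMap B B₀))
    (hk : RingHom.ker (algebraMap B B₀) = I.map (algebraMap A B)) :
    Algebra.IsPushout A (A ⧸ I) B B₀ := by
  let f : (A ⧸ I) ⊗[A] B →ₐ[A ⧸ I] B₀ := Algebra.TensorProduct.lift (Algebra.ofId _ _)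
    (IsScalarTower.toAlgHom A B B₀) fun _ _ ↦ .all _ _
  have hf (b : B) : f (1 ⊗ₜ b) = algebraMap B B₀ b := by simp [f]
  have hbij : Function.Bijective f := by
    constructor
    · rw [injective_iff_map_eq_zero]
      intro x hx
      obtain ⟨x, rfl⟩ := (Algebra.TensorProduct.quotIdealMapEquivQuotTensor B I).surjective x
      obtain ⟨b, rfl⟩ := Ideal.Quotient.mk_surjective x
      rw [Algebra.TensorProduct.quotIdealMapEquivQuotTensor_mk, hf] at hx
      rw [Ideal.Quotient.eq_zero_iff_mem.mpr (hk ▸ hx), map_zero]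
    · intro x
      obtain ⟨b, rfl⟩ := hs x
      exact ⟨_, hf b⟩
  exact ⟨IsBaseChange.of_equiv (AlgEquiv.ofBijective f hbij).toLinearEquiv hf⟩

variable [CommRing C] [CommRing C₀]
  [Algebra A C] [Algebra A C₀] [Algebra (A ⧸ I) C₀] [Algebra C C₀] [IsScalarTower A (A ⧸ I) C₀]
  [IsScalarTower A C C₀]

/-- C₀ need not be the reduction of C; with C = C₀ = Ω this factors geometric points over A/I
through B₀. -/
lemma exists_reduction [Algebra.IsPushout A (A ⧸ I) B B₀] (f : B →ₐ[A] C) :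
    ∃ f₀ : B₀ →ₐ[A ⧸ I] C₀, ∀ b, f₀ (algebraMap B B₀ b) = algebraMap C C₀ (f b) := by
  let g : (A ⧸ I) ⊗[A] B →ₐ[A ⧸ I] C₀ := Algebra.TensorProduct.lift (Algebra.ofId _ _)
    ((IsScalarTower.toAlgHom A C C₀).comp f) fun _ _ ↦ .all _ _
  refine ⟨g.comp (Algebra.IsPushout.equiv A (A ⧸ I) B B₀).symm.toAlgHom, fun b ↦ ?_⟩
  have : (Algebra.IsPushout.equiv A (A ⧸ I) B B₀).symm (algebraMap B B₀ b) = 1 ⊗ₜ b := by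
    rw [AlgEquiv.symm_apply_eq, Algebra.IsPushout.equiv_tmul, map_one, one_mul]
  change g ((Algebra.IsPushout.equiv A (A ⧸ I) B B₀).symm (algebraMap B B₀ b)) = _
  rw [this]
  simp [g]

variable [Algebra.IsPushout A (A ⧸ I) C C₀]

lemma exists_lift_algHom [IsNoetherianRing A] [HenselianRing A I] [Module.Finite A B]
    [Algebra.Etale A B] [Module.Finite A C] (f₀ : B₀ →ₐ[A ⧸ I] C₀) :
    ∃ f : B →ₐ[A] C, ∀ b, algebraMap C C₀ (f b) = f₀ (algebraMap B B₀ b) := by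
  have hk := ker_algebraMap_of_isPushout I C C₀
  have hs := algebraMap_surjective_of_isPushout I C C₀
  let e : (C ⧸ I.map (algebraMap A C)) ≃ₐ[A] C₀ :=
    AlgEquiv.ofBijective (Ideal.Quotient.liftₐ _ (IsScalarTower.toAlgHom A C C₀)
      fun a ha ↦ by rwa [← hk] at ha) (by
      constructor
      · rw [injective_iff_map_eq_zero]
        intro x hx
        obtain ⟨x, rfl⟩ := Ideal.Quotient.mk_surjective x
        rw [Ideal.Quotient.eq_zero_iff_mem, ← hk]
        exact hx
      · intro x
        obtain ⟨x, rfl⟩ := hs x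
        exact ⟨Ideal.Quotient.mk _ x, rfl⟩)
  obtain ⟨f, hf⟩ := exists_algHom_lift_of_finite_etale (I := I)
    (e.symm.toAlgHom.comp ((f₀.restrictScalars A).comp (IsScalarTower.toAlgHom A B B₀)))
  refine ⟨f, fun b ↦ ?_⟩
  have := congrArg e (hf b)
  change _ = e (e.symm _) at this
  rw [e.apply_symm_apply] at this
  exact this

lemma algHom_eq_of_algebraMap_eq (hI : I ≤ Ideal.jacobson ⊥) [Algebra.FormallyUnramified A B]
    [Algebra.EssFiniteType A B] [Module.Finite A C] {f g : B →ₐ[A] C}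
    (h : ∀ b, algebraMap C C₀ (f b) = algebraMap C C₀ (g b)) : f = g := by
  refine algHom_eq_of_sub_mem_jacobson f g fun b ↦ map_le_jacobson_bot hI C ?_
  rw [← ker_algebraMap_of_isPushout I C C₀, RingHom.mem_ker, map_sub, h, sub_self]

end Reduction

end TameRigidity

namespace TameRigidity

open TensorProduct

/-! ### The Galois condition is detected on A/I -/

section Galois

lemma connectedSpace_primeSpectrum_iff {B : Type*} [CommRing B] :
    ConnectedSpace (PrimeSpectrum B) ↔
      Nontrivial B ∧ ∀ e : B, IsIdempotentElem e → e = 0 ∨ e = 1 := by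
  have hz : (PrimeSpectrum.isIdempotentElemEquivClopens ⟨(0 : B), .zero⟩ :
      Set (PrimeSpectrum B)) = ∅ := by
    rw [PrimeSpectrum.coe_isIdempotentElemEquivClopens_apply]; simp
  have ho : (PrimeSpectrum.isIdempotentElemEquivClopens ⟨(1 : B), .one⟩ :
      Set (PrimeSpectrum B)) = Set.univ := by
    rw [PrimeSpectrum.coe_isIdempotentElemEquivClopens_apply]; simp
  constructor
  · intro h
    refine ⟨PrimeSpectrum.nonempty_iff_nontrivial.mp h.toNonempty, fun e he ↦ ?_⟩
    have h1 := preconnectedSpace_iff_clopen.mp h.toPreconnectedSpace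
      (PrimeSpectrum.isIdempotentElemEquivClopens ⟨e, he⟩ : Set (PrimeSpectrum B))
      (PrimeSpectrum.isIdempotentElemEquivClopens ⟨e, he⟩).isClopen
    rw [← hz, ← ho, SetLike.coe_set_eq, SetLike.coe_set_eq, EmbeddingLike.apply_eq_iff_eq,
      EmbeddingLike.apply_eq_iff_eq] at h1
    simpa using h1
  · rintro ⟨h1, h2⟩
    have : PreconnectedSpace (PrimeSpectrum B) := by
      refine preconnectedSpace_iff_clopen.mpr fun s hs ↦ ?_
      obtain ⟨⟨e, he⟩, h⟩ := PrimeSpectrum.isIdempotentElemEquivClopens.surjective ⟨s, hs⟩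
      have h3 : (PrimeSpectrum.isIdempotentElemEquivClopens ⟨e, he⟩ : Set (PrimeSpectrum B)) = s :=
        congrArg SetLike.coe h
      rw [← h3]
      rcases h2 e he with rfl | rfl
      · exact .inl hz
      · exact .inr ho
    exact { toNonempty := inferInstance }

/-- Idempotents of B and B/IB correspond: they lift by henselianity, and an idempotent in IB
vanishes because IB is in the Jacobson radical. -/
lemma connectedSpace_iff_of_isPushout {A : Type*} [CommRing A] [IsNoetherianRing A] {I : Ideal A}
    [HenselianRing A I] {B B₀ : Type*} [CommRing B] [CommRing B₀] [Algebra A B] [Algebra A B₀]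
    [Algebra (A ⧸ I) B₀] [Algebra B B₀] [IsScalarTower A (A ⧸ I) B₀] [IsScalarTower A B B₀]
    [Algebra.IsPushout A (A ⧸ I) B B₀] [Module.Finite A B] :
    ConnectedSpace (PrimeSpectrum B) ↔ ConnectedSpace (PrimeSpectrum B₀) := by
  have hs := algebraMap_surjective_of_isPushout I B B₀
  have hk := ker_algebraMap_of_isPushout I B B₀
  have hJ : I.map (algebraMap A B) ≤ Ideal.jacobson ⊥ := map_le_jacobson_bot HenselianRing.jac B
  rw [connectedSpace_primeSpectrum_iff, connectedSpace_primeSpectrum_iff]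
  constructor
  · rintro ⟨h1, h2⟩
    refine ⟨?_, fun e he ↦ ?_⟩
    · refine ⟨0, 1, fun h ↦ ?_⟩
      have h3 : (1 : B) ∈ Ideal.jacobson ⊥ := hJ (by
        rw [← hk, RingHom.mem_ker, map_one, h])
      have := Ideal.mem_jacobson_bot.mp h3 (-1)
      simp at this
    · obtain ⟨b, rfl⟩ := hs e
      obtain ⟨e, he1, he2⟩ := exists_isIdempotentElem_sub_mem (I := I) b (by
        rw [← hk, RingHom.mem_ker, map_sub, map_mul, he.eq, sub_self])
      rw [← hk, RingHom.mem_ker, map_sub, sub_eq_zero] at he2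
      rw [← he2]
      rcases h2 e he1 with rfl | rfl <;> simp
  · rintro ⟨h1, h2⟩
    refine ⟨(algebraMap B B₀).domain_nontrivial, fun e he ↦ ?_⟩
    rcases h2 _ (he.map (algebraMap B B₀)) with h | h
    · exact .inl (IsIdempotentElem.eq_zero_of_mem_jacobson he (hJ (hk ▸ h)))
    · refine .inr (sub_eq_zero.mp (IsIdempotentElem.eq_zero_of_mem_jacobson he.one_sub
        (hJ (hk ▸ ?_)))).symm
      rw [RingHom.mem_ker, map_sub, h, map_one, sub_self]

/-- The sections `(s, t)` of `Spec (B ⊗ B)` lying on the graph of `σ` are detected by a single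
element. -/
lemma lift_map_elem_ne_zero_iff {A B Ω : Type*} [CommRing A] [CommRing B] [Algebra A B]
    [Algebra.FormallyUnramified A B] [Algebra.EssFiniteType A B] [Field Ω] [Algebra A Ω]
    (s t : B →ₐ[A] Ω) (σ : B →ₐ[A] B) :
    Algebra.TensorProduct.lift s t (fun _ _ ↦ .all _ _)
      (Algebra.TensorProduct.map σ (.id A B) (Algebra.FormallyUnramified.elem A B)) ≠ 0 ↔
      t = s.comp σ := by
  have hcomp (x : B ⊗[A] B) : Algebra.TensorProduct.lift s t (fun _ _ ↦ .all _ _)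
      (Algebra.TensorProduct.map σ (.id A B) x) =
      Algebra.TensorProduct.lift (s.comp σ) t (fun _ _ ↦ .all _ _) x := by
    induction x with
    | zero => simp
    | tmul x y => simp
    | add x y hx hy => rw [map_add, map_add, map_add, hx, hy]
  rw [hcomp]
  constructor
  · intro h
    ext b
    have := congrArg (Algebra.TensorProduct.lift (s.comp σ) t (fun _ _ ↦ .all _ _))
      (Algebra.FormallyUnramified.one_tmul_sub_tmul_one_mul_elem (R := A) b)
    rw [map_mul, map_zero, mul_eq_zero, or_iff_left h] at this
    simpa [sub_eq_zero] using this
  · rintro rfl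
    have (x : B ⊗[A] B) : Algebra.TensorProduct.lift (s.comp σ) (s.comp σ)
        (fun _ _ ↦ .all _ _) x = s.comp σ (Algebra.TensorProduct.lmul' A x) := by
      induction x with
      | zero => simp
      | tmul x y => simp
      | add x y hx hy => rw [map_add, map_add, map_add, hx, hy]
    rw [this]
    have h1 := Algebra.FormallyUnramified.lmul_elem (R := A) (S := B)
    rw [h1, map_one]
    exact one_ne_zero

/-- The elements γ(σ) cut out the graphs of the automorphisms in Spec (B ⊗ B), and transitivity
follows once they generate the unit ideal. A maximal ideal of B ⊗ B containing them all would lie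
over I and give two geometric points over A/I; the automorphism of B₀ relating them lifts to B, a
contradiction. -/
lemma transitive_of_transitive_quotient {A : Type u} [CommRing A] [IsNoetherianRing A]
    {I : Ideal A} [HenselianRing A I] {B B₀ : Type u} [CommRing B] [CommRing B₀] [Algebra A B]
    [Algebra A B₀] [Algebra (A ⧸ I) B₀] [Algebra B B₀] [IsScalarTower A (A ⧸ I) B₀]
    [IsScalarTower A B B₀] [Algebra.IsPushout A (A ⧸ I) B B₀] [Module.Finite A B]
    [Algebra.Etale A B]
    (H : ∀ (Ω : Type u) [Field Ω] [IsAlgClosed Ω] [Algebra (A ⧸ I) Ω] (s t : B₀ →ₐ[A ⧸ I] Ω),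
      ∃ σ : B₀ ≃ₐ[A ⧸ I] B₀, t = s.comp (σ : B₀ →ₐ[A ⧸ I] B₀))
    (Ω : Type u) [Field Ω] [Algebra A Ω] (s t : B →ₐ[A] Ω) :
    ∃ σ : B ≃ₐ[A] B, t = s.comp (σ : B →ₐ[A] B) := by
  let E := B ⊗[A] B
  have : Module.Finite A E := .trans B E
  let γ (σ : B ≃ₐ[A] B) : E := Algebra.TensorProduct.map (σ : B →ₐ[A] B) (.id A B)
    (Algebra.FormallyUnramified.elem A B)
  have hspan : Ideal.span (Set.range γ) = ⊤ := by
    by_contra hne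
    obtain ⟨M, hM, hle⟩ := Ideal.exists_le_maximal _ hne
    let := Ideal.Quotient.field M
    let Ω' := AlgebraicClosure (E ⧸ M)
    let u : E →ₐ[A] Ω' := (IsScalarTower.toAlgHom A (E ⧸ M) Ω').comp (Ideal.Quotient.mkₐ A M)
    have hu (x : E) : u x = 0 ↔ x ∈ M := by
      change algebraMap (E ⧸ M) Ω' (Ideal.Quotient.mk M x) = 0 ↔ _
      rw [map_eq_zero_iff _ (algebraMap (E ⧸ M) Ω').injective, Ideal.Quotient.eq_zero_iff_mem]
    have hI0 : ∀ a ∈ I, algebraMap A Ω' a = 0 := by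
      intro a ha
      rw [← u.commutes, hu]
      have h1 := map_le_jacobson_bot HenselianRing.jac E (Ideal.mem_map_of_mem (algebraMap A E) ha)
      exact (sInf_le ⟨bot_le, hM⟩ : Ideal.jacobson ⊥ ≤ M) h1
    let : Algebra (A ⧸ I) Ω' := (Ideal.Quotient.lift I (algebraMap A Ω') hI0).toAlgebra
    have : IsScalarTower A (A ⧸ I) Ω' := .of_algebraMap_eq fun _ ↦ rfl
    let s' : B →ₐ[A] Ω' := u.comp Algebra.TensorProduct.includeLeft
    let t' : B →ₐ[A] Ω' := u.comp Algebra.TensorProduct.includeRight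
    obtain ⟨s₀, hs₀⟩ := exists_reduction (I := I) (B₀ := B₀) (C₀ := Ω') s'
    obtain ⟨t₀, ht₀⟩ := exists_reduction (I := I) (B₀ := B₀) (C₀ := Ω') t'
    obtain ⟨σ₀, hσ₀⟩ := H Ω' s₀ t₀
    obtain ⟨f, hf⟩ := exists_lift_algHom (I := I) (B := B) (C := B) (σ₀ : B₀ →ₐ[A ⧸ I] B₀)
    obtain ⟨g, hg⟩ := exists_lift_algHom (I := I) (B := B) (C := B) (σ₀.symm : B₀ →ₐ[A ⧸ I] B₀)
    let σ : B ≃ₐ[A] B := .ofAlgHom f g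
      (algHom_eq_of_algebraMap_eq (I := I) (C₀ := B₀) HenselianRing.jac fun b ↦ by simp [hf, hg])
      (algHom_eq_of_algebraMap_eq (I := I) (C₀ := B₀) HenselianRing.jac fun b ↦ by simp [hf, hg])
    have hst : t' = s'.comp (σ : B →ₐ[A] B) := by
      ext b
      have h1 := ht₀ b
      have h2 := hs₀ (σ b)
      rw [hσ₀] at h1
      change s₀ (σ₀ (algebraMap B B₀ b)) = t' b at h1
      change s₀ (algebraMap B B₀ (f b)) = s' (σ b) at h2
      rw [hf] at h2
      exact h1.symm.trans h2
    have hlift : Algebra.TensorProduct.lift s' t' (fun _ _ ↦ .all _ _) = u := by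
      ext <;> simp [s', t'] <;> rfl
    refine (lift_map_elem_ne_zero_iff s' t' (σ : B →ₐ[A] B)).mpr hst ?_
    rw [hlift, hu]
    exact hle (Ideal.subset_span ⟨σ, rfl⟩)
  by_contra! hne
  have h1 : Ideal.span (Set.range γ) ≤
      RingHom.ker (Algebra.TensorProduct.lift s t (fun _ _ ↦ .all _ _)) := by
    rw [Ideal.span_le]
    rintro _ ⟨σ, rfl⟩
    by_contra hσ
    exact hne σ ((lift_map_elem_ne_zero_iff s t (σ : B →ₐ[A] B)).mp hσ)
  rw [hspan] at h1
  have h2 := h1 (Submodule.mem_top (x := (1 : E)))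
  rw [RingHom.mem_ker, map_one] at h2
  exact one_ne_zero h2

lemma transitive_quotient_of_transitive {A : Type u} [CommRing A] 
    {I : Ideal A} {B B₀ : Type u} [CommRing B] [CommRing B₀] [Algebra A B]
    [Algebra A B₀] [Algebra (A ⧸ I) B₀] [Algebra B B₀] [IsScalarTower A (A ⧸ I) B₀]
    [IsScalarTower A B B₀] [Algebra.IsPushout A (A ⧸ I) B B₀]
    (H : ∀ (Ω : Type u) [Field Ω] [IsAlgClosed Ω] [Algebra A Ω] (s t : B →ₐ[A] Ω),
      ∃ σ : B ≃ₐ[A] B, t = s.comp (σ : B →ₐ[A] B))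
    (Ω : Type u) [Field Ω] [IsAlgClosed Ω] [Algebra (A ⧸ I) Ω] (s t : B₀ →ₐ[A ⧸ I] Ω) :
    ∃ σ : B₀ ≃ₐ[A ⧸ I] B₀, t = s.comp (σ : B₀ →ₐ[A ⧸ I] B₀) := by
  let : Algebra A Ω := ((algebraMap (A ⧸ I) Ω).comp (algebraMap A (A ⧸ I))).toAlgebra
  have : IsScalarTower A (A ⧸ I) Ω := .of_algebraMap_eq' rfl
  obtain ⟨σ, hσ⟩ := H Ω ((s.restrictScalars A).comp (IsScalarTower.toAlgHom A B B₀))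
    ((t.restrictScalars A).comp (IsScalarTower.toAlgHom A B B₀))
  have hs := algebraMap_surjective_of_isPushout I B B₀
  obtain ⟨f, hf⟩ := exists_reduction (I := I) (B₀ := B₀) (C₀ := B₀) (σ : B →ₐ[A] B)
  obtain ⟨g, hg⟩ := exists_reduction (I := I) (B₀ := B₀) (C₀ := B₀) (σ.symm : B →ₐ[A] B)
  refine ⟨.ofAlgHom f g ?_ ?_, ?_⟩
  · ext x
    obtain ⟨x, rfl⟩ := hs x
    simp [hf, hg]
  · ext x
    obtain ⟨x, rfl⟩ := hs x
    simp [hf, hg]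
  · ext x
    obtain ⟨x, rfl⟩ := hs x
    have := DFunLike.congr_fun hσ x
    simpa [hf] using this

/-- A finite étale cover of `A` is Galois iff its restriction to `A ⧸ I` is. -/
theorem isGaloisCover_iff {A : Type u} [CommRing A] [IsNoetherianRing A]
    {I : Ideal A} [HenselianRing A I] {B B₀ : Type u} [CommRing B] [CommRing B₀] [Algebra A B]
    [Algebra A B₀] [Algebra (A ⧸ I) B₀] [Algebra B B₀] [IsScalarTower A (A ⧸ I) B₀]
    [IsScalarTower A B B₀] [Algebra.IsPushout A (A ⧸ I) B B₀] [Module.Finite A B]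
    [Algebra.Etale A B] : IsGaloisCover A B ↔ IsGaloisCover (A ⧸ I) B₀ := by
  constructor
  · rintro ⟨h1, h2, h3⟩
    refine ⟨connectedSpace_iff_of_isPushout (A := A) (I := I) (B := B) |>.mp h1, ?_,
      transitive_quotient_of_transitive h3⟩
    have h := isPullback_specMap A (A ⧸ I) B B₀
    have hs : Surjective (specMap A B) := ⟨h2⟩
    exact (MorphismProperty.of_isPullback h.flip hs).surj
  · rintro ⟨h1, h2, h3⟩
    exact ⟨connectedSpace_iff_of_isPushout (A := A) (I := I) (B₀ := B₀) |>.mpr h1,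
      comap_surjective_of_comap_surjective_quotient (I := I) (B₀ := B₀) HenselianRing.jac h2,
      fun Ω _ _ _ ↦ transitive_of_transitive_quotient h3 Ω⟩

end Galois

end TameRigidity

namespace TameRigidity

open TensorProduct

/-! ### The equivalence of categories -/

section Equivalence

attribute [local instance] Algebra.TensorProduct.rightAlgebra

variable {A : Type u} [CommRing A] [IsNoetherianRing A] {I : Ideal A} [HenselianRing A I]

instance faithful_baseChange_quotient :
    (CommAlgCat.FiniteEtale.baseChange.{u} A (A ⧸ I)).Faithful where
  map_injective {B C} f g h := by
    apply ObjectProperty.hom_ext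
    apply CommAlgCat.hom_ext
    refine algHom_eq_of_algebraMap_eq (I := I) (C₀ := (A ⧸ I) ⊗[A] C.obj) HenselianRing.jac
      fun b ↦ ?_
    have := congrArg (fun k ↦ k.hom.hom ((1 : A ⧸ I) ⊗ₜ[A] b)) h
    exact this

instance full_baseChange_quotient :
    (CommAlgCat.FiniteEtale.baseChange.{u} A (A ⧸ I)).Full where
  map_surjective {B C} f := by
    let f' : (A ⧸ I) ⊗[A] B.obj →ₐ[A ⧸ I] (A ⧸ I) ⊗[A] C.obj := f.hom.hom
    obtain ⟨g, hg⟩ := exists_lift_algHom (I := I) (B := B.obj) (C := C.obj) f'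
    have h : Algebra.TensorProduct.map (.id (A ⧸ I) (A ⧸ I)) g = f' :=
      Algebra.TensorProduct.ext (by ext) (AlgHom.ext fun b ↦ hg b)
    exact ⟨CommAlgCat.FiniteEtale.ofHom g,
      ObjectProperty.hom_ext _ (CommAlgCat.hom_ext h)⟩

/-- Properties of finite étale covers which can be checked on the special fibre define equivalent
categories over `A` and `A ⧸ I`. -/
theorem inducesEquivalence_baseChange (P : ObjectProperty (CommAlgCat.FiniteEtale.{u} A))
    (Q : ObjectProperty (CommAlgCat.FiniteEtale.{u} (A ⧸ I)))
    (h : ∀ (B : CommAlgCat.FiniteEtale.{u} A) (B₀ : CommAlgCat.FiniteEtale.{u} (A ⧸ I))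
      [Algebra A B₀.obj] [Algebra B.obj B₀.obj] [IsScalarTower A (A ⧸ I) B₀.obj]
      [IsScalarTower A B.obj B₀.obj] [Algebra.IsPushout A (A ⧸ I) B.obj B₀.obj], P B ↔ Q B₀) :
    InducesEquivalence (CommAlgCat.FiniteEtale.baseChange.{u} A (A ⧸ I)) P Q := by
  let F := CommAlgCat.FiniteEtale.baseChange.{u} A (A ⧸ I)
  have hF (B : CommAlgCat.FiniteEtale.{u} A) (hB : P B) : Q (F.obj B) := by
    let T := (A ⧸ I) ⊗[A] B.obj
    let i1 : Algebra A T := Algebra.TensorProduct.leftAlgebra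
    let i2 : Algebra B.obj T := Algebra.TensorProduct.rightAlgebra
    have h1 : IsScalarTower A (A ⧸ I) T := inferInstance
    have h2 : IsScalarTower A B.obj T := inferInstance
    have h3 : Algebra.IsPushout A (A ⧸ I) B.obj T := inferInstance
    exact (@h B (F.obj B) i1 i2 h1 h2 h3).mp hB
  refine ⟨hF, ?_⟩
  have : (Q.lift (P.ι ⋙ F) (fun X ↦ hF X.obj X.property)).EssSurj := by
    refine ⟨fun Y ↦ ?_⟩
    let : Algebra A Y.obj.obj := ((algebraMap (A ⧸ I) Y.obj.obj).comp
      (algebraMap A (A ⧸ I))).toAlgebra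
    have : IsScalarTower A (A ⧸ I) Y.obj.obj := .of_algebraMap_eq' rfl
    obtain ⟨B, _, _, _, _, q, hq, hk⟩ := exists_finite_etale_lift (I := I) (B₀ := Y.obj.obj)
    let : Algebra B Y.obj.obj := q.toRingHom.toAlgebra
    have : IsScalarTower A B Y.obj.obj := .of_algebraMap_eq' q.comp_algebraMap.symm
    have : Algebra.IsPushout A (A ⧸ I) B Y.obj.obj := isPushout_of_surjective_of_ker_eq hq hk
    let B' := CommAlgCat.FiniteEtale.of A B
    have hB' : P B' := (h B' Y.obj).mpr Y.property
    let e : F.obj B' ≅ Y.obj :=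
      CommAlgCat.FiniteEtale.isoMk (Algebra.IsPushout.equiv A (A ⧸ I) B Y.obj.obj)
    exact ⟨⟨B', hB'⟩, ⟨Q.isoMk e⟩⟩
  have : F.Full := full_baseChange_quotient
  have : F.Faithful := faithful_baseChange_quotient
  exact { }

end Equivalence

end TameRigidity

theorem mainTheorem12 (R : Type u) [CommRing R] [IsDomain R] [IsDiscreteValuationRing R]
    [HenselianLocalRing R] (π : R) (hπ : Irreducible π)
    (A : Type u) [CommRing A] [Algebra R A] [Algebra.EssFiniteType R A]
    (I : Ideal A) (hI : I = Ideal.span {algebraMap R A π}) [HenselianRing A I] :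
    TameRigidity.InducesEquivalence (CommAlgCat.FiniteEtale.baseChange.{u} A (A ⧸ I))
      (TameRigidity.curveTameCovers R A) (TameRigidity.curveTameCovers R (A ⧸ I)) ∧
    (TameRigidity.IsGeometricallyUnibranch A → TameRigidity.IsGeometricallyUnibranch (A ⧸ I) →
      TameRigidity.InducesEquivalence (CommAlgCat.FiniteEtale.baseChange.{u} A (A ⧸ I))
        (TameRigidity.tameGaloisCovers R A) (TameRigidity.tameGaloisCovers R (A ⧸ I))) := by
  have : IsNoetherianRing A := Algebra.EssFiniteType.isNoetherianRing R A
  refine ⟨TameRigidity.inducesEquivalence_baseChange _ _ fun B B₀ _ _ _ _ _ ↦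
    TameRigidity.isCurveTame_iff hπ hI, fun _ _ ↦
    TameRigidity.inducesEquivalence_baseChange _ _ fun B B₀ _ _ _ _ _ ↦
    and_congr (TameRigidity.isGaloisCover_iff (I := I)) (TameRigidity.isTameCovering_iff hπ hI)⟩
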